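/- Let $1\le p\le n$ be integers, $0<\lambda\le\Lambda$, $b,c\ge 0$, and let $\Omega\subseteq\mathbb R^n$ be a domain (more generally, any open set). Let $\mathcal S^n$ be the space of real symmetric $n\times n$ matrices, let $e_1(X)\le\dots\le e_n(X)$ be the eigenvalues of $X\in\mathcal S^n$, and put $$\mathcal P^+_{\lambda,\Lambda|p}(X)=\Lambda\sum_{i=n-p+1}^n e_i^+(X)-\lambda\sum_{i=n-p+1}^n e_i^-(X),\qquad e_i^\pm(X)=\max(\pm e_i(X),0).$$ Let $F:\mathbb R\times\mathbb R^n\times\mathcal S^n\to\mathbb R$ satisfy the structure condition $$\text{(SC)}\qquad F(t,\eta,Y)-F(s,\xi,X)\le\mathcal P^+_{\lambda,\Lambda|p}(Y-X)+b|\eta-\xi|-c(t-s)$$ for all $s,t\in\mathbb R$, $\xi,\eta\in\mathbb R^n$, $X,Y\in\mathcal S^n$. For $G:\mathbb R\times\mathbb R^n\times\mathcal S^n\to\mathbb R$ and $h\in C(\Omega)$, an upper semicontinuous $u:\Omega\to[-\infty,+\infty)$ is a viscosity subsolution of $G(u,Du,D^2u)=h$ in $\Omega$ (that is, $G(u,Du,D^2u)\ge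 h$ in the viscosity sense) if $G(u(x_0),D\phi(x_0),D^2\phi(x_0))\ge h(x_0)$ whenever $x_0\in\Omega$, $u(x_0)>-\infty$, $\phi\in C^2(\Omega)$ and $u-\phi$ has a local maximum at $x_0$. A lower semicontinuous $v:\Omega\to(-\infty,+\infty]$ is a viscosity supersolution of $G(v,Dv,D^2v)=h$ in $\Omega$ if $G(v(x_0),D\phi(x_0),D^2\phi(x_0))\le h(x_0)$ whenever $x_0\in\Omega$, $v(x_0)<+\infty$, $\phi\in C^2(\Omega)$ and $v-\phi$ has a local minimum at $x_0$. Let $f,g\in C(\Omega)$, let $u$ be a viscosity subsolution of $F(u,Du,D^2u)=f$ in $\Omega$ and let $v$ be a viscosity supersolution of $F(v,Dv,D^2v)=g$ in $\Omega$. Then $w=u-v$ is upper semicontinuous from $\Omega$ to $[-\infty,+\infty)$ and is a viscosity subsolution of $$\mathcal P^+_{\lambda,\Lambda|p}(D^2w)+b|Dw|-cw=f-g\quad\text{in }\Omega,$$ that is, the left-hand side is $\ge f-g$ in the viscosity sense. -/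

import Mathlib

noncomputable section

namespace DegeneratePucci

/-- `ℝⁿ` with the Euclidean norm. -/
abbrev Euc (n : ℕ) : Type := EuclideanSpace ℝ (Fin n)

/-- `𝒮ⁿ`: the real symmetric `n × n` matrices (over `ℝ`, self-adjoint means symmetric). -/
abbrev SymMat (n : ℕ) : Type := selfAdjoint (Matrix (Fin n) (Fin n) ℝ)

theorem SymMat.isHermitian {n : ℕ} (X : SymMat n) :
    (X : Matrix (Fin n) (Fin n) ℝ).IsHermitian :=
  selfAdjoint.mem_iff.mp X.2

/-- The eigenvalues of `X`, with multiplicity, in nondecreasing order; the index `i : Fin n`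
is zero-based, so `eig X i` is the eigenvalue `e_{i+1}(X)`. (Mathlib's `eigenvalues₀` lists
them in nonincreasing order, whence `Fin.rev`.) -/
def eig {n : ℕ} (X : SymMat n) (i : Fin n) : ℝ :=
  X.isHermitian.eigenvalues₀ (Fin.cast (Fintype.card_fin n).symm i.rev)

/-- The Pucci maximal operator of order `p`: `Λ ∑ e_i(X)⁺ - λ ∑ e_i(X)⁻`, where both sums are over
the `p` largest eigenvalues `e_{n-p+1}(X), …, e_n(X)`. -/
def pucciMax {n : ℕ} (lam Lam : ℝ) (p : ℕ) (X : SymMat n) : ℝ :=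
  Lam * ∑ i ∈ Finset.univ.filter (fun i : Fin n => n - p ≤ i.val), max (eig X i) 0
    - lam * ∑ i ∈ Finset.univ.filter (fun i : Fin n => n - p ≤ i.val), max (-eig X i) 0

/-- The structure condition on `F(t, ξ, X)`. -/
def StructureCondition {n : ℕ} (lam Lam : ℝ) (p : ℕ) (b c : ℝ)
    (F : ℝ → Euc n → SymMat n → ℝ) : Prop :=
  ∀ (s t : ℝ) (ξ η : Euc n) (X Y : SymMat n),
    F t η Y - F s ξ X ≤ pucciMax lam Lam p (Y - X) + b * ‖η - ξ‖ - c * (t - s)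

/-- The matrix of second partial derivatives of `φ` at `x`. -/
def hessianMatrix {n : ℕ} (φ : Euc n → ℝ) (x : Euc n) : Matrix (Fin n) (Fin n) ℝ :=
  Matrix.of fun i j =>
    fderiv ℝ (fderiv ℝ φ) x (EuclideanSpace.single i 1) (EuclideanSpace.single j 1)

theorem hessianMatrix_mem {n : ℕ} {φ : Euc n → ℝ} {x : Euc n} (h : ContDiffAt ℝ 2 φ x) :
    hessianMatrix φ x ∈ selfAdjoint (Matrix (Fin n) (Fin n) ℝ) := by
  rw [selfAdjoint.mem_iff, Matrix.star_eq_conjTranspose]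
  ext i j
  have hs : IsSymmSndFDerivAt ℝ φ x := h.isSymmSndFDerivAt (by simp)
  simpa [hessianMatrix] using
    hs.eq (EuclideanSpace.single j 1) (EuclideanSpace.single i 1)

/-- The Hessian `D²φ(x)`, as a symmetric matrix, of a function that is `C²` near `x`. -/
def hessian {n : ℕ} (φ : Euc n → ℝ) (x : Euc n) (h : ContDiffAt ℝ 2 φ x) : SymMat n :=
  ⟨hessianMatrix φ x, hessianMatrix_mem h⟩

theorem contDiffAt_of_mem {n : ℕ} {Ω : TopologicalSpace.Opens (Euc n)} {φ : Euc n → ℝ}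
    (hφ : ContDiffOn ℝ 2 φ Ω) {x : Euc n} (hx : x ∈ Ω) : ContDiffAt ℝ 2 φ x :=
  hφ.contDiffAt (Ω.isOpen.mem_nhds hx)

/-- `u ∈ USC(Ω)`, `u : Ω → [-∞, +∞)`, is a viscosity subsolution of `F(u, Du, D²u) = f` in `Ω`,
i.e. `F(u, Du, D²u) ≥ f` in the viscosity sense. Only the values of `u` and `f` in `Ω` matter. -/
structure IsViscositySubsolution {n : ℕ} (Ω : TopologicalSpace.Opens (Euc n))
    (F : ℝ → Euc n → SymMat n → ℝ) (f : Euc n → ℝ) (u : Euc n → EReal) : Prop where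
  usc : UpperSemicontinuousOn u Ω
  lt_top : ∀ x ∈ Ω, u x < ⊤
  test : ∀ (x₀ : Euc n) (hx₀ : x₀ ∈ Ω), ⊥ < u x₀ →
    ∀ (φ : Euc n → ℝ) (hφ : ContDiffOn ℝ 2 φ Ω),
      IsLocalMaxOn (fun x => u x - (φ x : EReal)) Ω x₀ →
        f x₀ ≤ F (u x₀).toReal (gradient φ x₀) (hessian φ x₀ (contDiffAt_of_mem hφ hx₀))

/-- `v ∈ LSC(Ω)`, `v : Ω → (-∞, +∞]`, is a viscosity supersolution of `F(v, Dv, D²v) = g` in `Ω`,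
i.e. `F(v, Dv, D²v) ≤ g` in the viscosity sense. Only the values of `v` and `g` in `Ω` matter. -/
structure IsViscositySupersolution {n : ℕ} (Ω : TopologicalSpace.Opens (Euc n))
    (F : ℝ → Euc n → SymMat n → ℝ) (g : Euc n → ℝ) (v : Euc n → EReal) : Prop where
  lsc : LowerSemicontinuousOn v Ω
  bot_lt : ∀ x ∈ Ω, ⊥ < v x
  test : ∀ (x₀ : Euc n) (hx₀ : x₀ ∈ Ω), v x₀ < ⊤ →
    ∀ (φ : Euc n → ℝ) (hφ : ContDiffOn ℝ 2 φ Ω),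
      IsLocalMinOn (fun x => v x - (φ x : EReal)) Ω x₀ →
        F (v x₀).toReal (gradient φ x₀) (hessian φ x₀ (contDiffAt_of_mem hφ hx₀)) ≤ g x₀

end DegeneratePucci

end

noncomputable section

namespace DegeneratePucci

open Filter Topology MeasureTheory Metric Set
open scoped RealInnerProductSpace NNReal

/-! At a local maximum of u - v - φ the functions u and v need not be differentiable, so quadratics
touching u and -v from above at nearby points y and z take over. If these have derivatives (p₁, X₁)
and (p₂, X₂), the two viscosity inequalities and (SC) give f(y) - g(z) ≤ P⁺(X₁ + X₂) + b|p₁ + p₂| -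
c(u(y) - v(z)). As F does not depend on the space variable, only sums matter: it suffices that y, z
→ x₀, p₁ + p₂ → Dφ(x₀), X₁ + X₂ ≤ D²φ(x₀) + o(1), and that u(y) - v(z) does not drop below u(x₀) -
v(x₀) in the limit. Monotonicity of the Pucci operator and continuity of f and g then finish the
proof.

`exists_superjets` supplies the quadratics. The sup-convolutions of u and -v are evaluated at one
common point x, with y and z tied to x by the penalty k/2 (|x - y|² + |x - z|²). The Hessian bound
is therefore the ordinary second-order condition for the maximum of a sum
(`HasSecondOrderExpansion.add_le`), with no block matrices.

A maximum at which both convexified functions have second-order expansions comes from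
`exists_contact_hasSecondOrderExpansion`. The maximum is moved by small linear tilts q, and q is a
Lipschitz function of the maximum point. The maximum points lacking an expansion lie in a null set,
by Rademacher and Sard applied to the resolvents (1 + ∂f)⁻¹, and so cannot account for a whole ball
of tilts. -/

/-! ### Eigenvalues and monotonicity of the Pucci operator -/

/-- The quadratic form of a symmetric matrix. -/
def quadForm {n : ℕ} (X : SymMat n) (v : Euc n) : ℝ :=
  ⟪v, Matrix.toEuclideanLin (X : Matrix (Fin n) (Fin n) ℝ) v⟫

theorem exists_orthonormal_eigenbasis {n : ℕ} (X : SymMat n) :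
    ∃ b : OrthonormalBasis (Fin n) ℝ (Euc n), ∀ i,
      Matrix.toEuclideanLin (X : Matrix (Fin n) (Fin n) ℝ) (b i) = eig X i • b i := by
  have hs := Matrix.isSymmetric_toEuclideanLin_iff.mpr X.isHermitian
  refine ⟨(hs.eigenvectorBasis finrank_euclideanSpace).reindex
    ((finCongr (Fintype.card_fin n)).trans Fin.revPerm), fun i => ?_⟩
  rw [OrthonormalBasis.reindex_apply, hs.apply_eigenvectorBasis]
  rfl

theorem quadForm_eq_sum {n : ℕ} (X : SymMat n) (b : OrthonormalBasis (Fin n) ℝ (Euc n))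
    (hb : ∀ i, Matrix.toEuclideanLin (X : Matrix (Fin n) (Fin n) ℝ) (b i) = eig X i • b i)
    (v : Euc n) : quadForm X v = ∑ i, eig X i * ⟪b i, v⟫ ^ 2 := by
  have hs := Matrix.isSymmetric_toEuclideanLin_iff.mpr X.isHermitian
  rw [quadForm, ← b.sum_inner_mul_inner]
  refine Finset.sum_congr rfl fun i _ => ?_
  rw [← hs, hb, inner_smul_left, real_inner_comm v]
  simp
  ring

theorem eig_monotone {n : ℕ} (X : SymMat n) : Monotone (eig X) := fun i j hij =>
  X.isHermitian.eigenvalues₀_antitone (by simpa [Fin.le_def] using Fin.rev_le_rev.mpr hij)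

/-- Weyl's monotonicity principle for eigenvalues. -/
theorem eig_le_eig_add {n : ℕ} {X Y : SymMat n} {t : ℝ}
    (h : ∀ v, quadForm Y v ≤ quadForm X v + t * ‖v‖ ^ 2) (i : Fin n) :
    eig Y i ≤ eig X i + t := by
  obtain ⟨bX, hX⟩ := exists_orthonormal_eigenbasis X
  obtain ⟨bY, hY⟩ := exists_orthonormal_eigenbasis Y
  -- These are n - 1 linear conditions, so a nonzero v satisfies them all. Such a v has no
  -- components along eigenvectors of X above i or of Y below i, which puts its Rayleigh quotient
  -- for X below `eig X i` and that for Y above `eig Y i`.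
  let L : Euc n →ₗ[ℝ] ({j : Fin n // j ≠ i} → ℝ) := LinearMap.pi fun j =>
    if i < j.1 then (innerₛₗ ℝ (bX j.1)) else (innerₛₗ ℝ (bY j.1))
  have hL : LinearMap.ker L ≠ ⊥ := by
    apply LinearMap.ker_ne_bot_of_finrank_lt
    have := i.pos
    simp only [Module.finrank_fintype_fun_eq_card, finrank_euclideanSpace, Fintype.card_fin,
      Fintype.card_subtype_compl, Fintype.card_unique]
    omega
  obtain ⟨v, hv, hv0⟩ := Submodule.exists_mem_ne_zero_of_ne_bot hL
  have hv' : ∀ j, j ≠ i → (if i < j then ⟪bX j, v⟫ else ⟪bY j, v⟫) = 0 := fun j hj => by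
    have := congrFun (LinearMap.mem_ker.mp hv) ⟨j, hj⟩
    simp only [L, LinearMap.pi_apply] at this
    split_ifs at this ⊢ <;> simpa using this
  have h1 : quadForm X v ≤ eig X i * ‖v‖ ^ 2 := by
    rw [quadForm_eq_sum X bX hX, ← bX.sum_sq_inner_right, Finset.mul_sum]
    refine Finset.sum_le_sum fun j _ => ?_
    rcases le_or_gt j i with hj | hj
    · exact mul_le_mul_of_nonneg_right (eig_monotone X hj) (sq_nonneg _)
    · have := hv' j hj.ne'
      rw [if_pos hj] at this
      simp [this]
  have h2 : eig Y i * ‖v‖ ^ 2 ≤ quadForm Y v := by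
    rw [quadForm_eq_sum Y bY hY, ← bY.sum_sq_inner_right, Finset.mul_sum]
    refine Finset.sum_le_sum fun j _ => ?_
    rcases le_or_gt i j with hj | hj
    · exact mul_le_mul_of_nonneg_right (eig_monotone Y hj) (sq_nonneg _)
    · have := hv' j hj.ne
      rw [if_neg hj.not_gt] at this
      simp [this]
  have h3 : 0 < ‖v‖ ^ 2 := by positivity
  have := h v
  nlinarith

/-- Since 0 < λ ≤ Λ, the function e ↦ Λe⁺ - λe⁻ is nondecreasing with slopes at most Λ, so raising
the eigenvalues by at most t costs at most Λt in each of at most n terms. -/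
theorem pucciMax_le_add {n : ℕ} {lam Lam : ℝ} (hlam : 0 < lam) (hLam : lam ≤ Lam) (p : ℕ)
    {X Y : SymMat n} {t : ℝ} (ht : 0 ≤ t)
    (h : ∀ v, quadForm Y v ≤ quadForm X v + t * ‖v‖ ^ 2) :
    pucciMax lam Lam p Y ≤ pucciMax lam Lam p X + n * (Lam * t) := by
  have key : ∀ i, Lam * max (eig Y i) 0 - lam * max (-eig Y i) 0 ≤
      Lam * max (eig X i) 0 - lam * max (-eig X i) 0 + Lam * t := fun i => by
    have h1 := eig_le_eig_add h i
    have hL : 0 < Lam := hlam.trans_le hLam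
    have h2 := mul_nonneg hL.le (sub_nonneg.mpr h1)
    have h3 := mul_nonneg hlam.le (sub_nonneg.mpr h1)
    have h4 := mul_nonneg hL.le ht
    have h5 := mul_nonneg (sub_nonneg.mpr hLam) ht
    rcases le_total 0 (eig X i) with hx | hx <;> rcases le_total 0 (eig Y i) with hy | hy <;>
      simp only [max_eq_left, max_eq_right, hx, hy, neg_nonneg, neg_nonpos]
    · linarith
    · linarith [mul_nonneg hL.le hx, mul_nonneg hlam.le (neg_nonneg.mpr hy)]
    · linarith [mul_nonneg (sub_nonneg.mpr hLam) (neg_nonneg.mpr hx)]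
    · linarith
  simp only [pucciMax, Finset.mul_sum, ← Finset.sum_sub_distrib]
  calc _ ≤ ∑ i ∈ Finset.univ.filter (fun i : Fin n => n - p ≤ i.val),
        (Lam * max (eig X i) 0 - lam * max (-eig X i) 0 + Lam * t) :=
        Finset.sum_le_sum fun i _ => key i
    _ ≤ _ := by
        rw [Finset.sum_add_distrib, Finset.sum_const, nsmul_eq_mul]
        gcongr
        · exact mul_nonneg (hlam.le.trans hLam) ht
        · simpa using Finset.card_filter_le (Finset.univ : Finset (Fin n)) _

/-! ### Subdifferentials, resolvents and second-order expansions -/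

section Subgradients

variable {E : Type*} [NormedAddCommGroup E] [InnerProductSpace ℝ E]

/-- `p` is a (global) subgradient of `f` at `x`. -/
def IsSubgrad (f : E → ℝ) (x p : E) : Prop :=
  ∀ y, f x + ⟪p, y - x⟫ ≤ f y

theorem IsSubgrad.add {f g : E → ℝ} {x p q : E} (hp : IsSubgrad f x p) (hq : IsSubgrad g x q) :
    IsSubgrad (fun y => f y + g y) x (p + q) := fun y => by
  have h1 := hp y
  have h2 := hq y
  simp only [inner_add_left]
  linarith

/-- The second-order Taylor expansion of `f` at `x` with gradient `p` and Hessian form `B`. -/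
def HasSecondOrderExpansion (f : E → ℝ) (x p : E) (B : E →L[ℝ] E →L[ℝ] ℝ) : Prop :=
  ∀ σ > 0, ∀ᶠ y in 𝓝 x,
    |f y - f x - ⟪p, y - x⟫ - 1 / 2 * B (y - x) (y - x)| ≤ σ * ‖y - x‖ ^ 2

/-- The subdifferential is monotone, ⟪p - q, x - y⟫ ≥ 0, so 1 + ∂f does not decrease distances. -/
theorem IsSubgrad.norm_sub_le_of_add {f : E → ℝ} {x y p q : E} (hp : IsSubgrad f x p)
    (hq : IsSubgrad f y q) : ‖x - y‖ ≤ ‖(x + p) - (y + q)‖ := by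
  have h1 := hp y
  have h2 := hq x
  have h3 : ‖x - y‖ ^ 2 ≤ ⟪(x + p) - (y + q), x - y⟫ := by
    have e : (x + p) - (y + q) = (x - y) + (p - q) := by abel
    have e2 : y - x = -(x - y) := by abel
    rw [e2, inner_neg_right] at h1
    rw [e, inner_add_left, inner_sub_left p, real_inner_self_eq_norm_sq]
    linarith
  have h4 := real_inner_le_norm ((x + p) - (y + q)) (x - y)
  rcases (norm_nonneg (x - y)).eq_or_lt with h | h
  · rw [← h]; positivity
  · nlinarith

/-- The resolvent `(1 + ∂f)⁻¹` extends to a Lipschitz map. -/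
theorem exists_lipschitz_resolvent [FiniteDimensional ℝ E] (f : E → ℝ) :
    ∃ (K : ℝ≥0) (J : E → E), LipschitzWith K J ∧ ∀ x p, IsSubgrad f x p → J (x + p) = x := by
  classical
  let S : Set E := {z | ∃ x, IsSubgrad f x (z - x)}
  let j : E → E := fun z => if h : z ∈ S then h.choose else 0
  have hj : ∀ z ∈ S, IsSubgrad f (j z) (z - j z) := fun z hz => by
    simp only [j, dif_pos hz]
    exact hz.choose_spec
  have hlip : LipschitzOnWith 1 j S := by
    refine LipschitzOnWith.of_dist_le_mul fun z hz z' hz' => ?_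
    have := (hj z hz).norm_sub_le_of_add (hj z' hz')
    simpa [dist_eq_norm] using this
  -- The extension theorem may enlarge the Lipschitz constant 1, hence the unspecified `K`.
  obtain ⟨J, hJ, hJj⟩ := hlip.extend_finite_dimension
  refine ⟨_, J, hJ, fun x p hp => ?_⟩
  have hS : x + p ∈ S := ⟨x, by simpa using hp⟩
  rw [← hJj hS]
  have := (hj _ hS).norm_sub_le_of_add hp
  rw [add_sub_cancel, sub_self, norm_zero, norm_le_zero_iff, sub_eq_zero] at this
  exact this

/-- A supporting plane at y that is steeper than s would break through the paraboloid lying above f.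
The case y = x forces p = s. -/
theorem IsSubgrad.norm_sub_le_of_le_quadratic {f : E → ℝ} {x y s p : E} {C r : ℝ} (hC : 0 ≤ C)
    (hf : ∀ z ∈ ball x r, f z ≤ f x + ⟪s, z - x⟫ + C * ‖z - x‖ ^ 2)
    (hs : f x + ⟪s, y - x⟫ ≤ f y) (hp : IsSubgrad f y p) (hy : 2 * ‖y - x‖ < r) :
    ‖p - s‖ ≤ 4 * C * ‖y - x‖ := by
  rcases eq_or_ne (p - s) 0 with hk | hk
  · rw [hk, norm_zero]; positivity
  have hk' : 0 < ‖p - s‖ := norm_pos_iff.mpr hk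
  -- The probe h goes from y a distance t in the direction p - s. Taking t strictly above ‖y - x‖
  -- keeps t positive when y = x; then t decreases to ‖y - x‖.
  have key : ∀ t, ‖y - x‖ < t → 2 * t < r → ‖p - s‖ ≤ 4 * C * t := fun t ht htr => by
    have ht0 : 0 < t := (norm_nonneg _).trans_lt ht
    set h : E := (t / ‖p - s‖) • (p - s) with hh
    have hnh : ‖h‖ = t := by
      rw [hh, norm_smul, Real.norm_of_nonneg (by positivity)]
      field_simp
    have hin : ⟪p - s, h⟫ = t * ‖p - s‖ := by
      rw [hh, inner_smul_right, real_inner_self_eq_norm_sq]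
      field_simp
    have hn : ‖y + h - x‖ ≤ 2 * t := by
      calc ‖y + h - x‖ = ‖(y - x) + h‖ := by congr 1; abel
        _ ≤ ‖y - x‖ + ‖h‖ := norm_add_le _ _
        _ ≤ 2 * t := by linarith
    have h1 := hf (y + h) (by rw [mem_ball_iff_norm]; linarith)
    have h2 := hp (y + h)
    rw [add_sub_cancel_left] at h2
    have e : y + h - x = (y - x) + h := by abel
    have h3 : ⟪s, y + h - x⟫ = ⟪s, y - x⟫ + ⟪s, h⟫ := by rw [e, inner_add_right]
    rw [inner_sub_left] at hin
    have h4 : C * ‖y + h - x‖ ^ 2 ≤ C * (2 * t) ^ 2 := by gcongr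
    have h5 : t * ‖p - s‖ ≤ t * (4 * C * t) := by nlinarith
    exact le_of_mul_le_mul_left h5 ht0
  have htend : Tendsto (fun t => 4 * C * t) (𝓝[>] ‖y - x‖) (𝓝 (4 * C * ‖y - x‖)) :=
    ((continuous_const.mul continuous_id).tendsto _).mono_left nhdsWithin_le_nhds
  refine ge_of_tendsto htend ?_
  have h1 : ∀ᶠ t in 𝓝[>] ‖y - x‖, t < r / 2 :=
    nhdsWithin_le_nhds (Iio_mem_nhds (by linarith))
  filter_upwards [h1, self_mem_nhdsWithin] with t ht ht'
  exact key t ht' (by linarith)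

/-- Over N + 1 equal subintervals the quadratic errors add up to only C/(N + 1). -/
theorem abs_sub_le_of_forall_le_add_sq {e : ℝ → ℝ} {D C : ℝ}
    (h : ∀ s t, 0 ≤ s → s ≤ t → t ≤ 1 → |e t - e s| ≤ D * (t - s) + C * (t - s) ^ 2) :
    |e 1 - e 0| ≤ D := by
  have key : ∀ N : ℕ, |e 1 - e 0| ≤ D + C * (1 / ((N : ℝ) + 1)) := fun N => by
    have hN : (0 : ℝ) < N + 1 := by positivity
    have ind : ∀ k : ℕ, k ≤ N + 1 → |e (k / (N + 1)) - e 0| ≤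
        k * (D * (1 / ((N : ℝ) + 1)) + C * (1 / ((N : ℝ) + 1)) ^ 2) := fun k => by
      induction k with
      | zero => simp
      | succ k ih =>
        intro hk
        have h1 := ih (by omega)
        have e1 : ((k + 1 : ℕ) : ℝ) / (N + 1) - k / (N + 1) = 1 / ((N : ℝ) + 1) := by
          push_cast; field_simp; ring
        have hk' : ((k + 1 : ℕ) : ℝ) ≤ N + 1 := by exact_mod_cast hk
        have h2 := h (k / (N + 1)) ((k + 1 : ℕ) / (N + 1)) (by positivity)
          (by rw [← sub_nonneg, e1]; positivity) (by rwa [div_le_one hN])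
        rw [e1] at h2
        have h3 := abs_sub_le (e ((k + 1 : ℕ) / (N + 1))) (e (k / (N + 1))) (e 0)
        push_cast at *
        linarith
    have h1 := ind (N + 1) le_rfl
    have e1 : (((N + 1 : ℕ) : ℝ)) / (N + 1) = 1 := by push_cast; field_simp
    rw [e1] at h1
    refine h1.trans (le_of_eq ?_)
    push_cast
    field_simp
  have := (tendsto_one_div_add_atTop_nhds_zero_nat (𝕜 := ℝ)).const_mul C |>.const_add D
  rw [mul_zero, add_zero] at this
  exact ge_of_tendsto' this key

/-- A first-order expansion of the subdifferential integrates to a second-order expansion. -/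
theorem hasSecondOrderExpansion_of_subgrad {f : E → ℝ} (hf : ∀ y, ∃ p, IsSubgrad f y p)
    {x p₀ : E} {A : E →L[ℝ] E}
    (h : ∀ σ > 0, ∀ᶠ y in 𝓝 x, ∀ p, IsSubgrad f y p →
      ‖p - p₀ - A (y - x)‖ ≤ σ * ‖y - x‖) :
    HasSecondOrderExpansion f x p₀ ((innerSL ℝ).comp A) := by
  intro σ hσ
  obtain ⟨δ, hδ, hball⟩ := Metric.eventually_nhds_iff_ball.mp (h σ hσ)
  filter_upwards [ball_mem_nhds x hδ] with y hy
  set v := y - x with hv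
  have hvδ : ‖v‖ < δ := by rwa [mem_ball_iff_norm] at hy
  set a : ℝ := ⟪A v, v⟫ with ha
  choose P hP using hf
  have hPt : ∀ t, 0 ≤ t → t ≤ 1 →
      |⟪P (x + t • v), v⟫ - ⟪p₀, v⟫ - t * a| ≤ σ * ‖v‖ ^ 2 := fun t ht0 ht1 => by
    have hn : ‖t • v‖ ≤ ‖v‖ := by
      rw [norm_smul, Real.norm_of_nonneg ht0]
      exact mul_le_of_le_one_left (norm_nonneg _) ht1
    have h1 := hball (x + t • v) (by
      rw [mem_ball_iff_norm, add_sub_cancel_left]; exact hn.trans_lt hvδ) _ (hP _)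
    rw [add_sub_cancel_left] at h1
    have h2 : ⟪P (x + t • v), v⟫ - ⟪p₀, v⟫ - t * a =
        ⟪P (x + t • v) - p₀ - A (t • v), v⟫ := by
      rw [map_smul, inner_sub_left, inner_sub_left, real_inner_smul_left]
    rw [h2]
    refine (abs_real_inner_le_norm _ _).trans ?_
    calc _ ≤ (σ * ‖t • v‖) * ‖v‖ := by gcongr
      _ ≤ (σ * ‖v‖) * ‖v‖ := by gcongr
      _ = _ := by ring
  -- The Taylor remainder along the segment from x to y. Subgradients at both ends of a subinterval
  -- bound its increments, and replacing `a * (s + t) / 2` by `a * s` or `a * t` costs the term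
  -- quadratic in t - s.
  let e : ℝ → ℝ := fun t => f (x + t • v) - t * ⟪p₀, v⟫ - 1 / 2 * t ^ 2 * a
  have hbound : |e 1 - e 0| ≤ σ * ‖v‖ ^ 2 := by
    refine abs_sub_le_of_forall_le_add_sq (C := |a|) fun s t hs hst ht => ?_
    have h1 := abs_le.mp (hPt s hs (hst.trans ht))
    have h2 := abs_le.mp (hPt t (hs.trans hst) ht)
    have h3 := hP (x + s • v) (x + t • v)
    have h4 := hP (x + t • v) (x + s • v)
    have e1 : x + t • v - (x + s • v) = (t - s) • v := by rw [sub_smul]; abel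
    have e2 : x + s • v - (x + t • v) = (s - t) • v := by rw [sub_smul]; abel
    rw [e1, real_inner_smul_right] at h3
    rw [e2, real_inner_smul_right] at h4
    have hts : 0 ≤ t - s := sub_nonneg.mpr hst
    have h5 := mul_le_mul_of_nonneg_left h1.1 hts
    have h6 := mul_le_mul_of_nonneg_left h2.2 hts
    have h7 := mul_le_mul_of_nonneg_right (le_abs_self a) (sq_nonneg (t - s))
    have h8 := mul_le_mul_of_nonneg_right (neg_abs_le a) (sq_nonneg (t - s))
    have h9 := mul_nonneg (abs_nonneg a) (sq_nonneg (t - s))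
    rw [abs_le]
    constructor
    · simp only [e]
      linarith
    · simp only [e]
      linarith
  have e0 : e 1 - e 0 = f y - f x - ⟪p₀, v⟫ - 1 / 2 * a := by
    simp only [e, one_smul, zero_smul, add_zero, hv, add_sub_cancel]
    ring
  rw [e0] at hbound
  simpa [ha] using hbound

/-- With z = y + p one has y = J z and p = z - J z. Where J has an invertible derivative L this
yields p - p₀ = (L⁻¹ - 1)(y - x) up to a small error. The quadratic upper bound gives ‖z - z₀‖ ≤ (1
+ 4C)‖y - x‖, which makes that error o(‖y - x‖). -/
theorem exists_hasSecondOrderExpansion [FiniteDimensional ℝ E] {f : E → ℝ}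
    (hf : ∀ y, ∃ p, IsSubgrad f y p) {J : E → E}
    (hJ : ∀ x p, IsSubgrad f x p → J (x + p) = x) {x p₀ : E} (hp₀ : IsSubgrad f x p₀)
    {C r : ℝ} (hC : 0 ≤ C) (hr : 0 < r)
    (hfC : ∀ z ∈ ball x r, f z ≤ f x + ⟪p₀, z - x⟫ + C * ‖z - x‖ ^ 2)
    (hJd : DifferentiableAt ℝ J (x + p₀)) (hdet : (fderiv ℝ J (x + p₀)).det ≠ 0) :
    ∃ B, HasSecondOrderExpansion f x p₀ B := by
  set L := fderiv ℝ J (x + p₀) with hL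
  let L' : E ≃L[ℝ] E := L.toContinuousLinearEquivOfDetNeZero hdet
  set M : E →L[ℝ] E := (L'.symm : E →L[ℝ] E) with hM
  have hML : ∀ w, M (L w) = w := fun w => L'.symm_apply_apply w
  refine ⟨_, hasSecondOrderExpansion_of_subgrad (A := M - ContinuousLinearMap.id ℝ E) hf ?_⟩
  intro σ hσ
  set τ : ℝ := σ / ((‖M‖ + 1) * (1 + 4 * C)) with hτ
  have hden : 0 < (‖M‖ + 1) * (1 + 4 * C) := by positivity
  have hτ0 : 0 < τ := by positivity
  have hd := hJd.hasFDerivAt.isLittleO.def hτ0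
  obtain ⟨δ, hδ, hball⟩ := Metric.eventually_nhds_iff_ball.mp hd
  have hmin : 0 < min (r / 2) (δ / (1 + 4 * C)) := by positivity
  filter_upwards [ball_mem_nhds x hmin] with y hy p hp
  rw [mem_ball_iff_norm, lt_min_iff] at hy
  have h1 := IsSubgrad.norm_sub_le_of_le_quadratic hC hfC (hp₀ y) hp (by linarith)
  have e1 : y + p - (x + p₀) = (y - x) + (p - p₀) := by abel
  have h2 : ‖y + p - (x + p₀)‖ ≤ (1 + 4 * C) * ‖y - x‖ := by
    rw [e1]
    refine (norm_add_le _ _).trans ?_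
    linarith
  have h3 := hball (y + p) (by
    rw [mem_ball_iff_norm]
    have := (lt_div_iff₀ (by positivity)).mp hy.2
    linarith)
  rw [hJ y p hp, hJ x p₀ hp₀, ← hL] at h3
  have e2 : p - p₀ - (M - ContinuousLinearMap.id ℝ E) (y - x) =
      -M (y - x - L (y + p - (x + p₀))) := by
    rw [sub_apply, ContinuousLinearMap.id_apply, map_sub M (y - x), hML]
    abel
  rw [e2, norm_neg]
  calc _ ≤ ‖M‖ * (τ * ((1 + 4 * C) * ‖y - x‖)) := by
        refine (M.le_opNorm _).trans ?_
        gcongr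
        exact h3.trans (by gcongr)
    _ ≤ (‖M‖ + 1) * (τ * ((1 + 4 * C) * ‖y - x‖)) := by gcongr; linarith
    _ = σ * ‖y - x‖ := by rw [hτ]; field_simp

/-! ### Null sets and Jensen's lemma -/

theorem LipschitzOnWith.hausdorffMeasure_image_null [MeasurableSpace E] [BorelSpace E] {K : ℝ≥0}
    {f : E → E} {s : Set E} (hf : LipschitzOnWith K f s)
    (hs : (Measure.hausdorffMeasure (Module.finrank ℝ E) : Measure E) s = 0) :
    (Measure.hausdorffMeasure (Module.finrank ℝ E) : Measure E) (f '' s) = 0 := by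
  have := hf.hausdorffMeasure_image_le (d := Module.finrank ℝ E) (by positivity)
  rw [hs, mul_zero] at this
  exact nonpos_iff_eq_zero.mp this

/-- A Lipschitz map sends the set of its points of non-differentiability or of degenerate
derivative to a null set. -/
theorem LipschitzWith.image_degenerate_null [FiniteDimensional ℝ E] [MeasurableSpace E]
    [BorelSpace E] {K : ℝ≥0} {J : E → E} (hJ : LipschitzWith K J) :
    (Measure.hausdorffMeasure (Module.finrank ℝ E) : Measure E)
      (J '' {z | ¬ (DifferentiableAt ℝ J z ∧ (fderiv ℝ J z).det ≠ 0)}) = 0 := by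
  have hsub : J '' {z | ¬ (DifferentiableAt ℝ J z ∧ (fderiv ℝ J z).det ≠ 0)} ⊆
      J '' {z | ¬ DifferentiableAt ℝ J z} ∪
        J '' {z | DifferentiableAt ℝ J z ∧ (fderiv ℝ J z).det = 0} := by
    rw [← image_union]
    refine image_mono fun z hz => ?_
    by_cases h : DifferentiableAt ℝ J z
    · exact Or.inr ⟨h, by_contra fun h' => hz ⟨h, h'⟩⟩
    · exact Or.inl h
  -- Rademacher's theorem handles the first set, Sard's lemma the second; Hausdorff measure in the
  -- full dimension is a Haar measure.
  refine measure_mono_null hsub (measure_union_null ?_ ?_)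
  · exact LipschitzOnWith.hausdorffMeasure_image_null hJ.lipschitzOnWith
      (ae_iff.mp hJ.ae_differentiableAt)
  · exact addHaar_image_eq_zero_of_det_fderivWithin_eq_zero _
      (fun z hz => hz.1.hasFDerivAt.hasFDerivWithinAt) fun z hz => hz.2

/-- Jensen's lemma combined with Alexandrov's theorem: if `f₁ + f₂ - P` has maxima near `x₀` under
all small linear perturbations, then for one such perturbation both convex functions have a
second-order expansion at the maximum. -/
theorem exists_contact_hasSecondOrderExpansion [FiniteDimensional ℝ E] {f₁ f₂ P : E → ℝ}
    (hf₁ : ∀ x, ∃ p, IsSubgrad f₁ x p) (hf₂ : ∀ x, ∃ p, IsSubgrad f₂ x p)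
    {D : E → E} {K C : ℝ} (hK : 0 ≤ K) (hC : 0 ≤ C) (hD : ∀ x y, ‖D x - D y‖ ≤ K * ‖x - y‖)
    (hP : ∀ x y, P y ≤ P x + ⟪D x, y - x⟫ + C * ‖y - x‖ ^ 2) {x₀ : E} {r ρ : ℝ} (hr : 0 < r)
    (hρ : 0 < ρ) (hmax : ∀ q, ‖q‖ < ρ → ∃ x ∈ ball x₀ (r / 8),
      IsMaxOn (fun y => f₁ y + f₂ y - P y - ⟪q, y⟫) (closedBall x₀ r) x) :
    ∃ q x p₁ p₂ B₁ B₂, ‖q‖ < ρ ∧ x ∈ ball x₀ (r / 8) ∧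
      IsMaxOn (fun y => f₁ y + f₂ y - P y - ⟪q, y⟫) (closedBall x₀ r) x ∧
      IsSubgrad f₁ x p₁ ∧ IsSubgrad f₂ x p₂ ∧ p₁ + p₂ = D x + q ∧
      HasSecondOrderExpansion f₁ x p₁ B₁ ∧ HasSecondOrderExpansion f₂ x p₂ B₂ := by
  borelize E
  obtain ⟨K₁, J₁, hJ₁, hJ₁'⟩ := exists_lipschitz_resolvent f₁
  obtain ⟨K₂, J₂, hJ₂, hJ₂'⟩ := exists_lipschitz_resolvent f₂
  choose! X hXb hXm using hmax
  choose P₁ hP₁ using hf₁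
  choose P₂ hP₂ using hf₂
  have hball : ∀ q, ‖q‖ < ρ → ball (X q) (r / 2) ⊆ closedBall x₀ r := fun q hq =>
    (ball_subset_ball' (by have := mem_ball.mp (hXb q hq); linarith)).trans
      (ball_subset_closedBall (ε := r))
  have hG : ∀ q, ‖q‖ < ρ → ∀ z ∈ ball (X q) (r / 2), f₁ z + f₂ z ≤
      f₁ (X q) + f₂ (X q) + ⟪D (X q) + q, z - X q⟫ + C * ‖z - X q‖ ^ 2 := fun q hq z hz => by
    have h1 := isMaxOn_iff.mp (hXm q hq) z (hball q hq hz)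
    have h2 := hP (X q) z
    rw [inner_add_left, inner_sub_right q]
    linarith
  -- At `X q` the sum f₁ + f₂ lies under a paraboloid, so its subgradient there is unique.
  have hsum : ∀ q, ‖q‖ < ρ → P₁ (X q) + P₂ (X q) = D (X q) + q := fun q hq => by
    have := IsSubgrad.norm_sub_le_of_le_quadratic (f := fun y => f₁ y + f₂ y) hC (hG q hq)
      (by simp) ((hP₁ (X q)).add (hP₂ (X q))) (by simpa using hr)
    rwa [sub_self, norm_zero, mul_zero, norm_le_zero_iff, sub_eq_zero] at this
  by_contra hcon
  push Not at hcon
  set N₁ := J₁ '' {z | ¬ (DifferentiableAt ℝ J₁ z ∧ (fderiv ℝ J₁ z).det ≠ 0)}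
  set N₂ := J₂ '' {z | ¬ (DifferentiableAt ℝ J₂ z ∧ (fderiv ℝ J₂ z).det ≠ 0)}
  -- Subtracting the supporting plane of one function from the paraboloid above the sum leaves a
  -- paraboloid above the other. Outside `N₁ ∪ N₂` both functions would thus have expansions,
  -- against `hcon`.
  have hN : ∀ q, ‖q‖ < ρ → X q ∈ N₁ ∪ N₂ := fun q hq => by
    by_contra hq'
    rw [mem_union, not_or] at hq'
    have hg₁ : DifferentiableAt ℝ J₁ (X q + P₁ (X q)) ∧
        (fderiv ℝ J₁ (X q + P₁ (X q))).det ≠ 0 := by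
      by_contra h
      exact hq'.1 ⟨_, h, hJ₁' _ _ (hP₁ _)⟩
    have hg₂ : DifferentiableAt ℝ J₂ (X q + P₂ (X q)) ∧
        (fderiv ℝ J₂ (X q + P₂ (X q))).det ≠ 0 := by
      by_contra h
      exact hq'.2 ⟨_, h, hJ₂' _ _ (hP₂ _)⟩
    obtain ⟨B₁, hB₁⟩ := exists_hasSecondOrderExpansion (fun y => ⟨_, hP₁ y⟩) hJ₁' (hP₁ (X q))
      hC (half_pos hr) (fun z hz => by
        have h1 := hG q hq z hz
        have h2 := hP₂ (X q) z
        rw [← hsum q hq, inner_add_left] at h1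
        linarith) hg₁.1 hg₁.2
    obtain ⟨B₂, hB₂⟩ := exists_hasSecondOrderExpansion (fun y => ⟨_, hP₂ y⟩) hJ₂' (hP₂ (X q))
      hC (half_pos hr) (fun z hz => by
        have h1 := hG q hq z hz
        have h2 := hP₁ (X q) z
        rw [← hsum q hq, inner_add_left] at h1
        linarith) hg₂.1 hg₂.2
    exact hcon q (X q) _ _ B₁ B₂ hq (hXb q hq) (hXm q hq) (hP₁ _) (hP₂ _) (hsum q hq) hB₁ hB₂
  -- The tilt is a Lipschitz function of the contact point. Contact points within r/8 of x₀ are less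
  -- than r/4 apart, as the paraboloid of radius r/2 requires.
  have hanti : ∀ q q', ‖q‖ < ρ → ‖q'‖ < ρ → ‖q - q'‖ ≤ (4 * C + K) * ‖X q - X q'‖ :=
    fun q q' hq hq' => by
    have hd : ‖X q - X q'‖ < r / 4 := by
      have h1 := mem_ball.mp (hXb q hq)
      have h2 := mem_ball'.mp (hXb q' hq')
      rw [← dist_eq_norm]
      linarith [dist_triangle (X q) x₀ (X q')]
    have hs' := (hP₁ (X q')).add (hP₂ (X q'))
    have hs := (hP₁ (X q)).add (hP₂ (X q))
    rw [hsum q' hq'] at hs'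
    rw [hsum q hq] at hs
    have h1 := IsSubgrad.norm_sub_le_of_le_quadratic (f := fun y => f₁ y + f₂ y) hC (hG q' hq')
      (hs' (X q)) hs (by linarith)
    have e : q - q' = (D (X q) + q - (D (X q') + q')) - (D (X q) - D (X q')) := by abel
    rw [e]
    refine (norm_sub_le _ _).trans ?_
    have := hD (X q) (X q')
    linarith
  let Q : E → E := Function.invFunOn X (ball 0 ρ)
  have hinj : InjOn X (ball 0 ρ) := fun q hq q' hq' h => by
    have := hanti q q' (by simpa using hq) (by simpa using hq')
    rwa [h, sub_self, norm_zero, mul_zero, norm_le_zero_iff, sub_eq_zero] at this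
  have hQX : ∀ q ∈ ball (0 : E) ρ, Q (X q) = q := fun q hq => hinj.leftInvOn_invFunOn hq
  have hQlip : LipschitzOnWith (⟨4 * C + K, by positivity⟩ : ℝ≥0) Q (X '' ball 0 ρ) := by
    refine LipschitzOnWith.of_dist_le_mul ?_
    rintro _ ⟨q, hq, rfl⟩ _ ⟨q', hq', rfl⟩
    rw [hQX q hq, hQX q' hq', dist_eq_norm, dist_eq_norm]
    exact hanti q q' (by simpa using hq) (by simpa using hq')
  have hnull : (Measure.hausdorffMeasure (Module.finrank ℝ E) : Measure E) (X '' ball 0 ρ) = 0 := by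
    refine measure_mono_null ?_ (measure_union_null (LipschitzWith.image_degenerate_null hJ₁)
      (LipschitzWith.image_degenerate_null hJ₂))
    rintro _ ⟨q, hq, rfl⟩
    exact hN q (by simpa using hq)
  have hnull' := LipschitzOnWith.hausdorffMeasure_image_null hQlip hnull
  have himg : Q '' (X '' ball 0 ρ) = ball 0 ρ := by
    rw [image_image]
    exact (image_congr hQX).trans (image_id' _)
  rw [himg] at hnull'
  exact (measure_ball_pos _ (0 : E) hρ).ne' hnull'

end Subgradients

/-! ### Sup-convolutions -/

section SupConvolution

variable {E : Type*} [NormedAddCommGroup E] [InnerProductSpace ℝ E]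

/-- The inner product as a real bilinear form. -/
def innerForm (E : Type*) [NormedAddCommGroup E] [InnerProductSpace ℝ E] : E →L[ℝ] E →L[ℝ] ℝ := innerSL ℝ

theorem innerForm_apply_self (v : E) : innerForm E v v = ‖v‖ ^ 2 :=
  real_inner_self_eq_norm_sq v

/-- `f(x) = max_{y ∈ K} (u(y) - k|x - y|²/2) + k|x|²/2`, a convexified sup-convolution of `u`. -/
structure IsSupConvolution (k : ℝ) (K : Set E) (u : E → EReal) (f : E → ℝ) : Prop where
  attained : ∀ x, ∃ y ∈ K, ⊥ < u y ∧ f x = k * ⟪x, y⟫ + (u y).toReal - k / 2 * ‖y‖ ^ 2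
  le : ∀ x, ∀ y ∈ K, ⊥ < u y → k * ⟪x, y⟫ + (u y).toReal - k / 2 * ‖y‖ ^ 2 ≤ f x

theorem exists_isSupConvolution (k : ℝ) {K : Set E} (hK : IsCompact K) {u : E → EReal}
    (hu : UpperSemicontinuousOn u K) (htop : ∀ y ∈ K, u y < ⊤) (hne : ∃ y ∈ K, ⊥ < u y) :
    ∃ f, IsSupConvolution k K u f := by
  have key : ∀ x, ∃ y ∈ K, ⊥ < u y ∧ ∀ z ∈ K, ⊥ < u z →
      k * ⟪x, z⟫ + (u z).toReal - k / 2 * ‖z‖ ^ 2 ≤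
        k * ⟪x, y⟫ + (u y).toReal - k / 2 * ‖y‖ ^ 2 := fun x => by
    have hc : Continuous fun y : E => ((k * ⟪x, y⟫ - k / 2 * ‖y‖ ^ 2 : ℝ) : EReal) :=
      continuous_coe_real_ereal.comp (by fun_prop)
    have husc : UpperSemicontinuousOn
        (fun y => u y + ((k * ⟪x, y⟫ - k / 2 * ‖y‖ ^ 2 : ℝ) : EReal)) K :=
      hu.add' (hc.upperSemicontinuous.upperSemicontinuousOn K) fun y _ =>
        EReal.continuousAt_add (Or.inr (EReal.coe_ne_bot _)) (Or.inr (EReal.coe_ne_top _))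
    obtain ⟨z₀, hz₀, hz₀b⟩ := hne
    obtain ⟨y, hy, hmax⟩ := husc.exists_isMaxOn ⟨z₀, hz₀⟩ hK
    have hreal : ∀ z ∈ K, ⊥ < u z → ((u z).toReal : EReal) = u z := fun z hz hzb =>
      EReal.coe_toReal (htop z hz).ne hzb.ne'
    have hyb : ⊥ < u y := by
      by_contra h
      have h1 := isMaxOn_iff.mp hmax z₀ hz₀
      rw [not_bot_lt_iff.mp h, EReal.bot_add, ← hreal z₀ hz₀ hz₀b, ← EReal.coe_add,
        le_bot_iff] at h1
      exact EReal.coe_ne_bot _ h1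
    refine ⟨y, hy, hyb, fun z hz hzb => ?_⟩
    have h1 := isMaxOn_iff.mp hmax z hz
    rw [← hreal z hz hzb, ← hreal y hy hyb, ← EReal.coe_add, ← EReal.coe_add,
      EReal.coe_le_coe_iff] at h1
    linarith
  choose y hyK hyb hy using key
  exact ⟨fun x => k * ⟪x, y x⟫ + (u (y x)).toReal - k / 2 * ‖y x‖ ^ 2,
    fun x => ⟨y x, hyK x, hyb x, rfl⟩, hy⟩

namespace IsSupConvolution

variable {k : ℝ} {K : Set E} {u : E → EReal} {f : E → ℝ}

theorem exists_isSubgrad (h : IsSupConvolution k K u f) (x : E) :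
    ∃ y ∈ K, IsSubgrad f x (k • y) := by
  obtain ⟨y, hy, hyb, hfx⟩ := h.attained x
  refine ⟨y, hy, fun z => ?_⟩
  have := h.le z y hy hyb
  rw [hfx, real_inner_smul_left, inner_sub_right, real_inner_comm z, real_inner_comm x]
  linarith

/-- Every point has a subgradient `k • y` with y in the bounded set K, so f is Lipschitz. -/
theorem continuous (h : IsSupConvolution k K u f) (hK : Bornology.IsBounded K) :
    Continuous f := by
  obtain ⟨R, hR⟩ := hK.exists_norm_le
  have hR0 : 0 ≤ R := by
    obtain ⟨y, hy, -⟩ := h.attained 0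
    exact (norm_nonneg y).trans (hR y hy)
  have key : ∀ x z, f x - f z ≤ (|k| * R) * ‖x - z‖ := fun x z => by
    obtain ⟨y, hy, hs⟩ := h.exists_isSubgrad x
    have h1 := hs z
    have h2 := real_inner_le_norm (k • y) (x - z)
    have h3 : ⟪k • y, z - x⟫ = -⟪k • y, x - z⟫ := by rw [← inner_neg_right, neg_sub]
    rw [norm_smul, Real.norm_eq_abs] at h2
    have h4 : |k| * ‖y‖ * ‖x - z‖ ≤ |k| * R * ‖x - z‖ := by gcongr; exact hR y hy
    linarith
  refine (LipschitzWith.of_dist_le_mul (K := (|k| * R).toNNReal) fun x z => ?_).continuous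
  rw [Real.dist_eq, dist_eq_norm, Real.coe_toNNReal _ (by positivity)]
  refine abs_le.mpr ⟨?_, key x z⟩
  have := key z x
  rw [norm_sub_rev] at this
  linarith

/-- At a maximizing point `y`, a second-order expansion of the sup-convolution gives a quadratic
touching `u` from above. -/
theorem le_quadratic (h : IsSupConvolution k K u f) (htop : ∀ y ∈ K, u y < ⊤) {x y p : E}
    {B : E →L[ℝ] E →L[ℝ] ℝ} (hexp : HasSecondOrderExpansion f x p B) (hyK : K ∈ 𝓝 y)
    (hfx : f x = k * ⟪x, y⟫ + (u y).toReal - k / 2 * ‖y‖ ^ 2) {σ : ℝ} (hσ : 0 < σ) :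
    ∀ᶠ z in 𝓝 y, u z ≤ (((u y).toReal + (⟪p - k • x, z - y⟫ +
      1 / 2 * (B + (2 * σ - k) • innerForm E) (z - y) (z - y)) : ℝ) : EReal) := by
  -- Translating x together with y keeps x - y fixed, so z competes in the supremum defining f at x
  -- + (z - y). Removing the convexifying term k|x|²/2 produces the shift by -k.
  have ht : Tendsto (fun z => x + (z - y)) (𝓝 y) (𝓝 x) := by
    have : Continuous fun z => x + (z - y) := by fun_prop
    simpa using this.tendsto y
  filter_upwards [ht.eventually (hexp σ hσ), hyK] with z hz hzK
  rcases eq_bot_or_bot_lt (u z) with hb | hb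
  · rw [hb]; exact bot_le
  rw [← EReal.coe_toReal (htop z hzK).ne hb.ne', EReal.coe_le_coe_iff]
  have h1 := h.le (x + (z - y)) z hzK hb
  rw [add_sub_cancel_left] at hz
  have h2 := (abs_le.mp hz).2
  obtain ⟨v, rfl⟩ : ∃ v, z = y + v := ⟨z - y, by abel⟩
  rw [add_sub_cancel_left] at *
  have e1 : ⟪x + v, y + v⟫ = ⟪x, y⟫ + ⟪x, v⟫ + ⟪y, v⟫ + ‖v‖ ^ 2 := by
    rw [inner_add_left, inner_add_right, inner_add_right, real_inner_self_eq_norm_sq,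
      real_inner_comm y v]
    ring
  have e2 : (B + (2 * σ - k) • innerForm E) v v = B v v + (2 * σ - k) * ‖v‖ ^ 2 := by
    rw [← innerForm_apply_self]
    rfl
  rw [e1, norm_add_sq_real] at h1
  rw [e2, inner_sub_left, real_inner_smul_left]
  linarith

end IsSupConvolution

end SupConvolution

/-! ### Quadratic test functions and the passage from v to -v -/

section Quadratics

variable {n : ℕ}

/-- The symmetric matrix with the quadratic form `v ↦ B v v`. -/
def symPart (B : Euc n →L[ℝ] Euc n →L[ℝ] ℝ) : SymMat n :=
  ⟨Matrix.of fun i j => 1 / 2 * (B (EuclideanSpace.single i 1) (EuclideanSpace.single j 1) +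
      B (EuclideanSpace.single j 1) (EuclideanSpace.single i 1)), by
    rw [selfAdjoint.mem_iff, Matrix.star_eq_conjTranspose]
    ext i j
    simp [add_comm]⟩

theorem symPart_add (B B' : Euc n →L[ℝ] Euc n →L[ℝ] ℝ) :
    symPart (B + B') = symPart B + symPart B' := by
  ext i j
  simp [symPart]
  ring

theorem quadForm_symPart (B : Euc n →L[ℝ] Euc n →L[ℝ] ℝ) (v : Euc n) :
    quadForm (symPart B) v = B v v := by
  have hv : v = ∑ i, v i • EuclideanSpace.single i (1 : ℝ) := by
    simpa using ((EuclideanSpace.basisFun (Fin n) ℝ).sum_repr v).symm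
  have h1 : B v v = ∑ i, ∑ j, v i * (v j *
      B (EuclideanSpace.single i 1) (EuclideanSpace.single j 1)) := by
    conv_lhs => rw [hv]
    simp only [map_sum, map_smul, sum_apply, smul_apply,
      smul_eq_mul, Finset.mul_sum]
    rw [Finset.sum_comm]
    refine Finset.sum_congr rfl fun i _ => Finset.sum_congr rfl fun j _ => by ring
  have h2 : quadForm (symPart B) v = ∑ i, ∑ j, 1 / 2 * (v i * (v j *
      B (EuclideanSpace.single i 1) (EuclideanSpace.single j 1)) + v j * (v i *
      B (EuclideanSpace.single j 1) (EuclideanSpace.single i 1))) := by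
    simp only [quadForm, PiLp.inner_apply, Matrix.toLpLin_apply, Matrix.mulVec, dotProduct, symPart,
      Matrix.of_apply, RCLike.inner_apply, conj_trivial, Finset.sum_mul]
    refine Finset.sum_congr rfl fun i _ => Finset.sum_congr rfl fun j _ => by ring
  have h3 : B v v = ∑ i, ∑ j, v j * (v i *
      B (EuclideanSpace.single j 1) (EuclideanSpace.single i 1)) := by
    rw [h1, Finset.sum_comm]
  simp only [mul_add, Finset.sum_add_distrib] at h2
  simp only [← Finset.mul_sum _ _ (1 / 2 : ℝ)] at h2
  rw [← h1, ← h3] at h2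
  linarith

theorem hessian_eq_symPart {φ : Euc n → ℝ} {x : Euc n} (h : ContDiffAt ℝ 2 φ x) :
    hessian φ x h = symPart (fderiv ℝ (fderiv ℝ φ) x) := by
  have hs : IsSymmSndFDerivAt ℝ φ x := h.isSymmSndFDerivAt (by simp)
  ext i j
  simp only [hessian, hessianMatrix, symPart, Matrix.of_apply]
  rw [hs.eq (EuclideanSpace.single j 1) (EuclideanSpace.single i 1)]
  ring

/-- The quadratic polynomial `⟨p, y - y₀⟩ + B(y - y₀, y - y₀)/2`. -/
def quadPoly (y₀ p : Euc n) (B : Euc n →L[ℝ] Euc n →L[ℝ] ℝ) (y : Euc n) : ℝ :=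
  ⟪p, y - y₀⟫ + 1 / 2 * B (y - y₀) (y - y₀)

theorem contDiff_quadPoly (y₀ p : Euc n) (B : Euc n →L[ℝ] Euc n →L[ℝ] ℝ) :
    ContDiff ℝ 2 (quadPoly y₀ p B) := by
  have h1 : ContDiff ℝ 2 fun y => y - y₀ := contDiff_id.sub contDiff_const
  exact (contDiff_const.inner ℝ h1).add
    (contDiff_const.mul ((B.contDiff.comp h1).clm_apply h1))

theorem hasFDerivAt_quadPoly (y₀ p : Euc n) (B : Euc n →L[ℝ] Euc n →L[ℝ] ℝ) (y : Euc n) :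
    HasFDerivAt (quadPoly y₀ p B)
      (innerSL ℝ p + (1 / 2 : ℝ) • (B (y - y₀) + B.flip (y - y₀))) y := by
  have h1 : HasFDerivAt (fun y => y - y₀) (ContinuousLinearMap.id ℝ (Euc n)) y :=
    (hasFDerivAt_id y).sub_const y₀
  have h2 := ((innerSL ℝ p).hasFDerivAt.comp y h1).add
    (((B.hasFDerivAt.comp y h1).clm_apply h1).const_mul (1 / 2 : ℝ))
  refine h2.congr_fderiv ?_
  ext v
  simp

theorem gradient_quadPoly (y₀ p : Euc n) (B : Euc n →L[ℝ] Euc n →L[ℝ] ℝ) :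
    gradient (quadPoly y₀ p B) y₀ = p := by
  refine HasGradientAt.gradient ?_
  rw [hasGradientAt_iff_hasFDerivAt]
  refine (hasFDerivAt_quadPoly y₀ p B y₀).congr_fderiv ?_
  ext v
  simp

theorem hessian_quadPoly (y₀ p : Euc n) (B : Euc n →L[ℝ] Euc n →L[ℝ] ℝ)
    (h : ContDiffAt ℝ 2 (quadPoly y₀ p B) y₀) :
    hessian (quadPoly y₀ p B) y₀ h = symPart B := by
  have h1 : fderiv ℝ (quadPoly y₀ p B) = fun y =>
      innerSL ℝ p + ((1 / 2 : ℝ) • (B + B.flip)) (y - y₀) := by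
    ext1 y
    rw [(hasFDerivAt_quadPoly y₀ p B y).fderiv]
    rfl
  have h2 : HasFDerivAt (fderiv ℝ (quadPoly y₀ p B)) ((1 / 2 : ℝ) • (B + B.flip)) y₀ := by
    rw [h1]
    exact ((((1 / 2 : ℝ) • (B + B.flip)).hasFDerivAt.comp y₀
      ((hasFDerivAt_id y₀).sub_const y₀)).const_add _)
  ext i j
  simp only [hessian, hessianMatrix, symPart, h2.fderiv, Matrix.of_apply]
  rfl

theorem IsViscositySubsolution.le_of_quadPoly {Ω : TopologicalSpace.Opens (Euc n)}
    {F : ℝ → Euc n → SymMat n → ℝ} {f : Euc n → ℝ} {u : Euc n → EReal}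
    (hu : IsViscositySubsolution Ω F f u) {y₀ : Euc n} (hy₀ : y₀ ∈ Ω) (hb : ⊥ < u y₀)
    {p : Euc n} {B : Euc n →L[ℝ] Euc n →L[ℝ] ℝ}
    (h : ∀ᶠ y in 𝓝 y₀, u y ≤ (((u y₀).toReal + quadPoly y₀ p B y : ℝ) : EReal)) :
    f y₀ ≤ F (u y₀).toReal p (symPart B) := by
  have hc := contDiff_quadPoly y₀ p B
  have := hu.test y₀ hy₀ hb (quadPoly y₀ p B) hc.contDiffOn (by
    filter_upwards [nhdsWithin_le_nhds h] with y hy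
    have h0 : quadPoly y₀ p B y₀ = 0 := by simp [quadPoly]
    rw [h0, EReal.coe_zero, sub_zero]
    refine EReal.sub_le_of_le_add ?_
    rwa [← EReal.coe_toReal (hu.lt_top y₀ hy₀).ne hb.ne', ← EReal.coe_add])
  rwa [gradient_quadPoly, hessian_quadPoly] at this

/-- Turns the pair (u, v) into two subsolutions, so that sup-convolution serves for both. -/
theorem IsViscositySupersolution.neg {Ω : TopologicalSpace.Opens (Euc n)}
    {F : ℝ → Euc n → SymMat n → ℝ} {g : Euc n → ℝ} {v : Euc n → EReal}
    (hv : IsViscositySupersolution Ω F g v) :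
    IsViscositySubsolution Ω (fun t ξ X => -F (-t) (-ξ) (-X)) (fun x => -g x)
      (fun x => -v x) where
  usc := fun x hx a ha => by
    have ha' : -v x < a := ha
    filter_upwards [hv.lsc x hx (-a) (EReal.neg_lt_comm.mp ha')] with y hy
    exact EReal.neg_lt_comm.mp hy
  lt_top := fun x hx => by simpa [lt_top_iff_ne_top, bot_lt_iff_ne_bot] using hv.bot_lt x hx
  test := fun x₀ hx₀ hb φ hφ hmax => by
    have hb' : v x₀ < ⊤ := by
      rw [bot_lt_iff_ne_bot, Ne, EReal.neg_eq_bot_iff] at hb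
      exact lt_top_iff_ne_top.mpr hb
    have h1 := hv.test x₀ hx₀ hb' (fun y => -φ y) hφ.neg (by
      filter_upwards [hmax] with y hy
      have e : ∀ z, v z - ((-φ z : ℝ) : EReal) = -(-v z - (φ z : EReal)) := fun z => by
        rw [EReal.neg_sub (Or.inr (EReal.coe_ne_bot _)) (Or.inr (EReal.coe_ne_top _)), neg_neg,
          EReal.coe_neg, sub_eq_add_neg, neg_neg]
      rw [e, e]
      exact EReal.neg_le_neg_iff.mpr hy)
    have h2 : gradient (fun y => -φ y) x₀ = -gradient φ x₀ := by
      simp [gradient, fderiv_fun_neg]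
    have h3 : hessian (fun y => -φ y) x₀ (contDiffAt_of_mem hφ.neg hx₀) =
        -hessian φ x₀ (contDiffAt_of_mem hφ hx₀) := by
      have : fderiv ℝ (fun y => -φ y) = fun y => -fderiv ℝ φ y := by
        ext1 y; exact fderiv_fun_neg
      ext i j
      simp [hessian, hessianMatrix, this, fderiv_fun_neg]
    rw [h2, h3] at h1
    simpa using h1

end Quadratics

/-! ### Penalization -/

section Localization

theorem exists_coe_bound_of_upperSemicontinuousOn {α : Type*} [TopologicalSpace α] {K : Set α}
    (hK : IsCompact K) {u : α → EReal} (hu : UpperSemicontinuousOn u K)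
    (htop : ∀ y ∈ K, u y < ⊤) : ∃ M : ℝ, ∀ y ∈ K, u y ≤ M := by
  rcases K.eq_empty_or_nonempty with rfl | hne
  · exact ⟨0, by simp⟩
  obtain ⟨a, ha, hmax⟩ := hu.exists_isMaxOn hne hK
  exact ⟨(u a).toReal, fun y hy =>
    (isMaxOn_iff.mp hmax y hy).trans (EReal.le_coe_toReal (htop a ha).ne)⟩

/-- Splits a strict bound on a sum into separate real bounds, so that semicontinuity applies to each
summand even when one is -∞. -/
theorem EReal.exists_coe_gt_add_le {a b : EReal} {c : ℝ} (ha : a < ⊤) (hb : b < ⊤)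
    (h : a + b < c) : ∃ a' b' : ℝ, a < a' ∧ b < b' ∧ a' + b' ≤ c := by
  induction a with
  | top => exact absurd ha (lt_irrefl _)
  | bot =>
    obtain ⟨b', hb', -⟩ := EReal.lt_iff_exists_real_btwn.mp hb
    exact ⟨c - b', b', EReal.bot_lt_coe _, hb', by linarith⟩
  | coe a =>
    induction b with
    | top => exact absurd hb (lt_irrefl _)
    | bot => exact ⟨a + 1, c - (a + 1), by exact_mod_cast lt_add_one a, EReal.bot_lt_coe _,
        by linarith⟩
    | coe b =>
      have h' : a + b < c := by exact_mod_cast h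
      exact ⟨a + (c - a - b) / 2, b + (c - a - b) / 2, by
        rw [EReal.coe_lt_coe_iff]; linarith, by rw [EReal.coe_lt_coe_iff]; linarith, by linarith⟩

variable {E : Type*} [NormedAddCommGroup E]

/-- Localization of almost-maximizers when the variables are tripled. -/
theorem exists_penalty_localization {K : Set E} (hK : IsCompact K) {u v : E → EReal}
    (hu : UpperSemicontinuousOn u K) (hv : UpperSemicontinuousOn v K)
    (hut : ∀ y ∈ K, u y < ⊤) (hvt : ∀ y ∈ K, v y < ⊤) {Q : E → ℝ} (hQ : Continuous Q) {x₀ : E}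
    {m δ : ℝ} (hδ : 0 < δ)
    (hle : ∀ y ∈ K, u y + v y ≤ ((m + Q y - δ * ‖y - x₀‖ ^ 2 : ℝ) : EReal))
    {η : ℝ} (hη : 0 < η) :
    ∃ k > 0, ∃ κ > 0, ∀ x ∈ K, ∀ y ∈ K, ∀ z ∈ K, ⊥ < u y → ⊥ < v z →
      m - κ ≤ (u y).toReal + (v z).toReal - Q x - k / 2 * (‖x - y‖ ^ 2 + ‖x - z‖ ^ 2) →
      x ∈ ball x₀ η ∧ y ∈ ball x₀ η ∧ z ∈ ball x₀ η := by
  by_contra hcon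
  push Not at hcon
  have hj : ∀ j : ℕ, (0 : ℝ) < j + 1 := fun j => by positivity
  have hκ : ∀ j : ℕ, (0 : ℝ) < 1 / (j + 1) := fun j => by positivity
  -- Counterexamples with k = j + 1 and κ = 1/(j + 1). The penalty forces the three sequences to a
  -- common limit a along a subsequence; a ≠ x₀ then contradicts the strictness term δ‖a - x₀‖².
  choose x hx y hy z hz hyb hzb hm hout using fun j : ℕ => hcon (j + 1) (hj j) (1 / (j + 1)) (hκ j)
  have real_le : ∀ {w : EReal} {M : ℝ}, ⊥ < w → w ≤ M → w.toReal ≤ M := fun {w M} hb h => by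
    have := EReal.toReal_le_toReal h hb.ne' (EReal.coe_ne_top M)
    simpa using this
  obtain ⟨M₁, hM₁⟩ := exists_coe_bound_of_upperSemicontinuousOn hK hu hut
  obtain ⟨M₂, hM₂⟩ := exists_coe_bound_of_upperSemicontinuousOn hK hv hvt
  obtain ⟨a₃, ha₃, hM₃⟩ := hK.exists_isMinOn ⟨_, hx 0⟩ hQ.continuousOn
  set R := M₁ + M₂ - Q a₃ - m + 1 with hR
  have hsq : ∀ j, ‖x j - y j‖ ^ 2 + ‖x j - z j‖ ^ 2 ≤ 2 * R * (1 / ((j : ℝ) + 1)) := fun j => by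
    have h1 := hm j
    have h2 := real_le (hyb j) (hM₁ _ (hy j))
    have h3 := real_le (hzb j) (hM₂ _ (hz j))
    have h4 := isMinOn_iff.mp hM₃ _ (hx j)
    have h5 : 1 / ((j : ℝ) + 1) ≤ 1 := by
      rw [div_le_one (hj j)]; linarith [(Nat.cast_nonneg j : (0 : ℝ) ≤ j)]
    rw [mul_one_div, le_div_iff₀ (hj j)]
    linarith
  have hlim : Tendsto (fun j : ℕ => 2 * R * (1 / ((j : ℝ) + 1))) atTop (𝓝 0) := by
    simpa using (tendsto_one_div_add_atTop_nhds_zero_nat (𝕜 := ℝ)).const_mul (2 * R)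
  have hzero : ∀ w : ℕ → E, (∀ j, ‖x j - w j‖ ^ 2 ≤ 2 * R * (1 / ((j : ℝ) + 1))) →
      Tendsto (fun j => x j - w j) atTop (𝓝 0) := fun w hw => by
    rw [tendsto_zero_iff_norm_tendsto_zero]
    have h1 := squeeze_zero (fun j => sq_nonneg ‖x j - w j‖) hw hlim
    have h2 := h1.sqrt
    simpa [Real.sqrt_sq (norm_nonneg _)] using h2
  have hxy := hzero y fun j => by linarith [hsq j, sq_nonneg ‖x j - z j‖]
  have hxz := hzero z fun j => by linarith [hsq j, sq_nonneg ‖x j - y j‖]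
  obtain ⟨a, haK, s, hs, hxa⟩ := hK.tendsto_subseq hx
  have hya : Tendsto (y ∘ s) atTop (𝓝 a) := by
    simpa [Function.comp_def] using hxa.sub (hxy.comp hs.tendsto_atTop)
  have hza : Tendsto (z ∘ s) atTop (𝓝 a) := by
    simpa [Function.comp_def] using hxa.sub (hxz.comp hs.tendsto_atTop)
  have hane : a ≠ x₀ := by
    rintro rfl
    have hb := ball_mem_nhds a hη
    obtain ⟨j, h1, h2, h3⟩ := ((hxa.eventually hb).and
      ((hya.eventually hb).and (hza.eventually hb))).exists
    exact hout (s j) h1 h2 h3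
  have hd : 0 < δ * ‖a - x₀‖ ^ 2 := by
    have := norm_pos_iff.mpr (sub_ne_zero.mpr hane)
    positivity
  obtain ⟨b₁, b₂, hb₁, hb₂, hb⟩ := EReal.exists_coe_gt_add_le
    (c := m + Q a - δ * ‖a - x₀‖ ^ 2 / 2) (hut a haK) (hvt a haK)
    ((hle a haK).trans_lt (by rw [EReal.coe_lt_coe_iff]; linarith))
  have hya' : Tendsto (y ∘ s) atTop (𝓝[K] a) :=
    tendsto_nhdsWithin_iff.mpr ⟨hya, Eventually.of_forall fun j => hy _⟩
  have hza' : Tendsto (z ∘ s) atTop (𝓝[K] a) :=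
    tendsto_nhdsWithin_iff.mpr ⟨hza, Eventually.of_forall fun j => hz _⟩
  have hfin : ∀ᶠ j in atTop, m - 1 / ((s j : ℝ) + 1) + Q (x (s j)) ≤ b₁ + b₂ := by
    filter_upwards [hya'.eventually (hu a haK b₁ hb₁), hza'.eventually (hv a haK b₂ hb₂)]
      with j h1 h2
    have h3 := real_le (hyb (s j)) h1.le
    have h4 := real_le (hzb (s j)) h2.le
    have h5 := hm (s j)
    have h6 : 0 ≤ ((s j : ℝ) + 1) / 2 *
        (‖x (s j) - y (s j)‖ ^ 2 + ‖x (s j) - z (s j)‖ ^ 2) := by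
      have := hj (s j)
      positivity
    linarith
  have hlim2 : Tendsto (fun j => m - 1 / ((s j : ℝ) + 1) + Q (x (s j))) atTop
      (𝓝 (m - 0 + Q a)) :=
    (tendsto_const_nhds.sub ((tendsto_one_div_add_atTop_nhds_zero_nat (𝕜 := ℝ)).comp
      hs.tendsto_atTop)).add ((hQ.tendsto a).comp hxa)
  have := le_of_tendsto hlim2 hfin
  linarith

end Localization

/-! ### Second-order conditions and Taylor's theorem -/

section Expansions

variable {E : Type*} [NormedAddCommGroup E] [InnerProductSpace ℝ E]

/-- The second-order necessary condition at a point where `f₁ + f₂` is touched from above by a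
quadratic. -/
theorem HasSecondOrderExpansion.add_le {f₁ f₂ : E → ℝ} {x p₁ p₂ : E}
    {B₁ B₂ A : E →L[ℝ] E →L[ℝ] ℝ} (h₁ : HasSecondOrderExpansion f₁ x p₁ B₁)
    (h₂ : HasSecondOrderExpansion f₂ x p₂ B₂)
    (h : ∀ᶠ y in 𝓝 x, f₁ y + f₂ y ≤
      f₁ x + f₂ x + ⟪p₁ + p₂, y - x⟫ + 1 / 2 * A (y - x) (y - x)) (w : E) :
    B₁ w w + B₂ w w ≤ A w w := by
  have key : ∀ σ > 0, B₁ w w + B₂ w w ≤ A w w + σ * (4 * ‖w‖ ^ 2) := fun σ hσ => by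
    have ht : Tendsto (fun t : ℝ => x + t • w) (𝓝[>] 0) (𝓝 x) := by
      have : Continuous fun t : ℝ => x + t • w := by fun_prop
      simpa using (this.tendsto 0).mono_left nhdsWithin_le_nhds
    obtain ⟨t, ⟨h1, h2, h3⟩, ht0⟩ := ((ht.eventually ((h₁ σ hσ).and ((h₂ σ hσ).and h))).and
      (self_mem_nhdsWithin (s := Ioi (0 : ℝ)))).exists
    have ht0 : 0 < t := ht0
    simp only [add_sub_cancel_left, map_smul, smul_apply, smul_eq_mul, inner_add_left,
      norm_smul, Real.norm_of_nonneg ht0.le] at h1 h2 h3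
    have h4 := (abs_le.mp h1).1
    have h5 := (abs_le.mp h2).1
    have h6 : t ^ 2 * (B₁ w w + B₂ w w) ≤ t ^ 2 * (A w w + σ * (4 * ‖w‖ ^ 2)) := by
      nlinarith
    exact le_of_mul_le_mul_left h6 (by positivity)
  have htend : Tendsto (fun σ : ℝ => A w w + σ * (4 * ‖w‖ ^ 2)) (𝓝[>] 0) (𝓝 (A w w)) := by
    have : Continuous fun σ : ℝ => A w w + σ * (4 * ‖w‖ ^ 2) := by fun_prop
    simpa using (this.tendsto 0).mono_left nhdsWithin_le_nhds
  exact ge_of_tendsto htend (by filter_upwards [self_mem_nhdsWithin] with σ hσ using key σ hσ)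

variable {n : ℕ}

/-- Taylor's theorem of order two. -/
theorem hasSecondOrderExpansion_of_contDiffAt {φ : Euc n → ℝ} {x : Euc n}
    (h : ContDiffAt ℝ 2 φ x) :
    HasSecondOrderExpansion φ x (gradient φ x) (fderiv ℝ (fderiv ℝ φ) x) := by
  intro σ hσ
  set B := fderiv ℝ (fderiv ℝ φ) x with hB
  have hs : IsSymmSndFDerivAt ℝ φ x := h.isSymmSndFDerivAt (by simp)
  have hflip : B.flip = B := by
    ext v w
    exact hs.eq w v
  have hd1 : DifferentiableAt ℝ (fderiv ℝ φ) x :=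
    (h.fderiv_right (m := 1) (by norm_num)).differentiableAt (by norm_num)
  have hd2 : ∀ᶠ y in 𝓝 x, DifferentiableAt ℝ φ y := by
    filter_upwards [h.eventually (by simp)] with y hy
    exact hy.differentiableAt (by norm_num)
  obtain ⟨δ, hδ, hball⟩ := Metric.eventually_nhds_iff_ball.mp
    ((hd1.hasFDerivAt.isLittleO.def hσ).and hd2)
  filter_upwards [ball_mem_nhds x hδ] with y hy
  have hgrad : innerSL ℝ (gradient φ x) = fderiv ℝ φ x := by
    ext v
    simp [gradient]
  have hder : ∀ z ∈ closedBall x ‖y - x‖, HasFDerivAt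
      (fun z => φ z - quadPoly x (gradient φ x) B z)
      (fderiv ℝ φ z - fderiv ℝ φ x - B (z - x)) z := fun z hz => by
    have hzδ : z ∈ ball x δ := by
      rw [mem_closedBall_iff_norm] at hz
      rw [mem_ball_iff_norm] at hy ⊢
      linarith
    refine ((hball z hzδ).2.hasFDerivAt.sub
      (hasFDerivAt_quadPoly x (gradient φ x) B z)).congr_fderiv ?_
    rw [hflip, hgrad, ← two_smul ℝ (B (z - x)), smul_smul]
    norm_num
    abel
  have hmv := (convex_closedBall x ‖y - x‖).norm_image_sub_le_of_norm_hasFDerivWithin_le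
    (C := σ * ‖y - x‖) (fun z hz => (hder z hz).hasFDerivWithinAt) (fun z hz => by
      have hz' := mem_closedBall_iff_norm.mp hz
      have := (hball z (by rw [mem_ball_iff_norm] at hy ⊢; linarith)).1
      exact this.trans (by gcongr))
    (mem_closedBall_self (norm_nonneg _)) (mem_closedBall_iff_norm.mpr le_rfl)
  have e : φ y - quadPoly x (gradient φ x) B y - (φ x - quadPoly x (gradient φ x) B x) =
      φ y - φ x - ⟪gradient φ x, y - x⟫ - 1 / 2 * B (y - x) (y - x) := by
    simp [quadPoly]
    ring
  rw [e, Real.norm_eq_abs] at hmv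
  refine hmv.trans (le_of_eq ?_)
  ring

end Expansions

/-! ### The theorem on sums and the conclusion -/

variable {n : ℕ}

/-- The gradient map of `quadPoly x₀ p B + k‖·‖²` is affine, and this function has an exact
second-order Taylor formula. -/
theorem exists_affine_gradient (x₀ p : Euc n) (B : Euc n →L[ℝ] Euc n →L[ℝ] ℝ) :
    ∃ T : Euc n →L[ℝ] Euc n, ∀ (k : ℝ) (x y : Euc n),
      quadPoly x₀ p B y + k * ‖y‖ ^ 2 = quadPoly x₀ p B x + k * ‖x‖ ^ 2 +
        ⟪p + T (x - x₀) + (2 * k) • x, y - x⟫ +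
          1 / 2 * (B + (2 * k) • innerForm (Euc n)) (y - x) (y - x) := by
  refine ⟨InnerProductSpace.continuousLinearMapOfBilin ((1 / 2 : ℝ) • (B + B.flip)),
    fun k x y => ?_⟩
  obtain ⟨v, rfl⟩ : ∃ v, y = x + v := ⟨y - x, by abel⟩
  obtain ⟨h, rfl⟩ : ∃ h, x = x₀ + h := ⟨x - x₀, by abel⟩
  have e1 : x₀ + h + v - x₀ = h + v := by abel
  have e2 : (B + (2 * k) • innerForm (Euc n)) v v = B v v + 2 * k * ‖v‖ ^ 2 := by
    rw [← innerForm_apply_self]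
    rfl
  have e3 : x₀ + h + v - (x₀ + h) = v := by abel
  rw [e3, add_sub_cancel_left, norm_add_sq_real (x₀ + h) v, e2]
  simp only [inner_add_left, real_inner_smul_left,
    InnerProductSpace.continuousLinearMapOfBilin_apply, quadPoly, e1, add_sub_cancel_left, map_add, add_apply, smul_apply,
    ContinuousLinearMap.flip_apply, inner_add_right, smul_eq_mul]
  ring

/-- A form of the theorem on sums: at a strict maximum of `u + v - quadPoly x₀ p B`, two viscosity
subsolutions have quadratic superjets at nearby points whose sum is controlled by `(p, B)`. -/
theorem exists_superjets {Ω : TopologicalSpace.Opens (Euc n)} {F₁ F₂ : ℝ → Euc n → SymMat n → ℝ}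
    {f₁ f₂ : Euc n → ℝ} {u v : Euc n → EReal} (hu : IsViscositySubsolution Ω F₁ f₁ u)
    (hv : IsViscositySubsolution Ω F₂ f₂ v) {x₀ : Euc n} (hu₀ : ⊥ < u x₀) (hv₀ : ⊥ < v x₀)
    {r : ℝ} (hr : 0 < r) (hrΩ : closedBall x₀ r ⊆ (Ω : Set (Euc n)))
    {p : Euc n} {B : Euc n →L[ℝ] Euc n →L[ℝ] ℝ} {δ : ℝ} (hδ : 0 < δ)
    (hle : ∀ y ∈ closedBall x₀ r, u y + v y ≤
      (((u x₀).toReal + (v x₀).toReal + quadPoly x₀ p B y - δ * ‖y - x₀‖ ^ 2 : ℝ) : EReal))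
    {τ : ℝ} (hτ : 0 < τ) :
    ∃ y z p₁ p₂ B₁ B₂, y ∈ Ω ∧ z ∈ Ω ∧ y ∈ ball x₀ τ ∧ z ∈ ball x₀ τ ∧
      f₁ y ≤ F₁ (u y).toReal p₁ (symPart B₁) ∧ f₂ z ≤ F₂ (v z).toReal p₂ (symPart B₂) ∧
      ‖p₁ + p₂ - p‖ ≤ τ ∧ (∀ w, (B₁ + B₂) w w ≤ B w w + τ * ‖w‖ ^ 2) ∧
      (u x₀).toReal + (v x₀).toReal - τ ≤ (u y).toReal + (v z).toReal := by
  set K := closedBall x₀ r with hK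
  have hKc : IsCompact K := isCompact_closedBall x₀ r
  have hx₀K : x₀ ∈ K := mem_closedBall_self hr.le
  have hut : ∀ y ∈ K, u y < ⊤ := fun y hy => hu.lt_top y (hrΩ hy)
  have hvt : ∀ y ∈ K, v y < ⊤ := fun y hy => hv.lt_top y (hrΩ hy)
  set m := (u x₀).toReal + (v x₀).toReal with hm
  set Q := quadPoly x₀ p B with hQ
  have hQc : Continuous Q := (contDiff_quadPoly x₀ p B).continuous
  have hQ₀ : Q x₀ = 0 := by simp [hQ, quadPoly]
  obtain ⟨T, hT⟩ := exists_affine_gradient x₀ p B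
  obtain ⟨η₁, hη₁, hQη⟩ : ∃ η₁ > 0, ∀ x ∈ ball x₀ η₁, -(τ / 2) < Q x := by
    refine Metric.eventually_nhds_iff_ball.mp (hQc.tendsto x₀ (Ioi_mem_nhds ?_))
    rw [hQ₀]; linarith
  -- The four bounds serve, in order, the value estimate, closeness of y and z to x₀, the radius r/8
  -- in Jensen's lemma, and the gradient error ‖T‖η ≤ τ/2.
  set η := min (min η₁ τ) (min (r / 8) (τ / 2 / (‖T‖ + 1))) with hη
  have hη0 : 0 < η := by positivity
  have hηη₁ : η ≤ η₁ := (min_le_left _ _).trans (min_le_left _ _)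
  have hητ : η ≤ τ := (min_le_left _ _).trans (min_le_right _ _)
  have hηr : η ≤ r / 8 := (min_le_right _ _).trans (min_le_left _ _)
  have hηT : ‖T‖ * η ≤ τ / 2 := by
    have h1 : η ≤ τ / 2 / (‖T‖ + 1) := (min_le_right _ _).trans (min_le_right _ _)
    rw [le_div_iff₀ (by positivity)] at h1
    linarith
  obtain ⟨k, hk, κ, hκ, hloc⟩ := exists_penalty_localization hKc (hu.usc.mono hrΩ)
    (hv.usc.mono hrΩ) hut hvt hQc hδ hle hη0
  -- Between x₀ and any point of K the tilt changes by at most ρr ≤ min κ (τ/2), so tilted maxima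
  -- remain within reach of `hloc`.
  set ρ := min (min κ (τ / 2) / r) (τ / 2) with hρ
  have hρ0 : 0 < ρ := by positivity
  have hρr : ρ * r ≤ min κ (τ / 2) := (le_div_iff₀ hr).mp (min_le_left _ _)
  obtain ⟨g₁, hg₁⟩ := exists_isSupConvolution k hKc (hu.usc.mono hrΩ) hut ⟨x₀, hx₀K, hu₀⟩
  obtain ⟨g₂, hg₂⟩ := exists_isSupConvolution k hKc (hv.usc.mono hrΩ) hvt ⟨x₀, hx₀K, hv₀⟩
  -- Each `gᵢ` contains k|y|²/2, so k|y|² is subtracted from their sum; the resulting 2k in `A`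
  -- cancels the two shifts by -k in the touching quadratics.
  set P : Euc n → ℝ := fun y => Q y + k * ‖y‖ ^ 2 with hP
  set D : Euc n → Euc n := fun x => p + T (x - x₀) + (2 * k) • x with hD
  set A : Euc n →L[ℝ] Euc n →L[ℝ] ℝ := B + (2 * k) • innerForm (Euc n) with hA
  have hPT : ∀ x y, P y = P x + ⟪D x, y - x⟫ + 1 / 2 * A (y - x) (y - x) := hT k
  have hPC : ∀ x y, P y ≤ P x + ⟪D x, y - x⟫ + ‖A‖ * ‖y - x‖ ^ 2 := fun x y => by
    have h1 := (le_abs_self _).trans (A.le_opNorm₂ (y - x) (y - x))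
    have h2 : 0 ≤ ‖A‖ * ‖y - x‖ ^ 2 := by positivity
    rw [hPT x y]
    linarith
  have hDlip : ∀ x y, ‖D x - D y‖ ≤ (‖T‖ + 2 * k) * ‖x - y‖ := fun x y => by
    have e : D x - D y = T (x - y) + (2 * k) • (x - y) := by
      simp only [hD, map_sub, smul_sub]
      abel
    rw [e]
    refine (norm_add_le _ _).trans ?_
    rw [norm_smul, Real.norm_of_nonneg (by positivity), add_mul]
    gcongr
    exact T.le_opNorm _
  have hmax : ∀ q x, ‖q‖ < ρ → x ∈ K →
      IsMaxOn (fun y => g₁ y + g₂ y - P y - ⟪q, y⟫) K x → ∀ y ∈ K, ∀ z ∈ K, ⊥ < u y → ⊥ < v z →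
      g₁ x = k * ⟪x, y⟫ + (u y).toReal - k / 2 * ‖y‖ ^ 2 →
      g₂ x = k * ⟪x, z⟫ + (v z).toReal - k / 2 * ‖z‖ ^ 2 →
      (x ∈ ball x₀ η ∧ y ∈ ball x₀ η ∧ z ∈ ball x₀ η) ∧
        m - min κ (τ / 2) ≤ (u y).toReal + (v z).toReal - Q x := by
    intro q x hq hx hW y hy z hz hyb hzb hgy hgz
    have h1 := isMaxOn_iff.mp hW x₀ hx₀K
    have h2 := hg₁.le x₀ x₀ hx₀K hu₀
    have h3 := hg₂.le x₀ x₀ hx₀K hv₀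
    rw [real_inner_self_eq_norm_sq] at h2 h3
    have h4 : -(ρ * r) ≤ ⟪q, x⟫ - ⟪q, x₀⟫ := by
      rw [← inner_sub_right]
      have h5 := (abs_le.mp (abs_real_inner_le_norm q (x - x₀))).1
      have h6 : ‖q‖ * ‖x - x₀‖ ≤ ρ * r := by
        gcongr
        exact mem_closedBall_iff_norm.mp hx
      linarith
    have e1 := norm_sub_sq_real x y
    have e2 := norm_sub_sq_real x z
    have h7 : m - min κ (τ / 2) ≤ (u y).toReal + (v z).toReal - Q x -
        k / 2 * (‖x - y‖ ^ 2 + ‖x - z‖ ^ 2) := by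
      rw [e1, e2]
      simp only [hP, hQ₀, hgy, hgz] at h1
      linarith
    refine ⟨hloc x hx y hy z hz hyb hzb (by linarith [min_le_left κ (τ / 2)]), ?_⟩
    have : 0 ≤ k / 2 * (‖x - y‖ ^ 2 + ‖x - z‖ ^ 2) := by positivity
    linarith
  obtain ⟨q, x, p₁, p₂, B₁, B₂, hq, hx, hW, hp₁, hp₂, hpp, hB₁, hB₂⟩ :=
    exists_contact_hasSecondOrderExpansion (f₁ := g₁) (f₂ := g₂) (P := P) (x₀ := x₀)
      (fun x => let ⟨y, _, hy⟩ := hg₁.exists_isSubgrad x; ⟨_, hy⟩)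
      (fun x => let ⟨y, _, hy⟩ := hg₂.exists_isSubgrad x; ⟨_, hy⟩)
      (by positivity : 0 ≤ ‖T‖ + 2 * k) (norm_nonneg A) hDlip hPC hr hρ0 (fun q hq => by
        have hc : Continuous fun y => g₁ y + g₂ y - P y - ⟪q, y⟫ := by
          have h1 := hg₁.continuous isBounded_closedBall
          have h2 := hg₂.continuous isBounded_closedBall
          have h3 : Continuous P := hQc.add (by fun_prop)
          fun_prop
        obtain ⟨x, hx, hW⟩ := hKc.exists_isMaxOn ⟨x₀, hx₀K⟩ hc.continuousOn
        obtain ⟨y, hy, hyb, hgy⟩ := hg₁.attained x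
        obtain ⟨z, hz, hzb, hgz⟩ := hg₂.attained x
        exact ⟨x, ball_subset_ball hηr (hmax q x hq hx hW y hy z hz hyb hzb hgy hgz).1.1, hW⟩)
  have hxK : x ∈ K := ball_subset_closedBall (ball_subset_ball (by linarith) hx)
  obtain ⟨y, hy, hyb, hgy⟩ := hg₁.attained x
  obtain ⟨z, hz, hzb, hgz⟩ := hg₂.attained x
  obtain ⟨⟨hxη, hyη, hzη⟩, hval⟩ := hmax q x hq hxK hW y hy z hz hyb hzb hgy hgz
  have hnhds : ∀ w ∈ ball x₀ η, K ∈ 𝓝 w := fun w hw =>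
    mem_of_superset (isOpen_ball.mem_nhds (ball_subset_ball (by linarith : η ≤ r) hw))
      ball_subset_closedBall
  -- The choice σ = τ/4 adds 2σ = τ/2 to each Hessian, τ in total.
  have hj₁ := hu.le_of_quadPoly (hrΩ hy) hyb
    (hg₁.le_quadratic hut hB₁ (hnhds y hyη) hgy (by positivity : 0 < τ / 4))
  have hj₂ := hv.le_of_quadPoly (hrΩ hz) hzb
    (hg₂.le_quadratic hvt hB₂ (hnhds z hzη) hgz (by positivity : 0 < τ / 4))
  refine ⟨y, z, _, _, _, _, hrΩ hy, hrΩ hz, ball_subset_ball hητ hyη, ball_subset_ball hητ hzη,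
    hj₁, hj₂, ?_, fun w => ?_, ?_⟩
  · have e : p₁ - k • x + (p₂ - k • x) - p = T (x - x₀) + q := by
      have e1 : p₁ - k • x + (p₂ - k • x) - p = (p₁ + p₂) - (2 * k) • x - p := by
        rw [two_mul, add_smul]
        abel
      rw [e1, hpp]
      simp only [hD]
      abel
    rw [e]
    have h1 : ‖T (x - x₀)‖ ≤ ‖T‖ * η := by
      refine (T.le_opNorm _).trans ?_
      gcongr
      exact (mem_ball_iff_norm.mp hxη).le
    have h2 := norm_add_le (T (x - x₀)) q
    linarith [min_le_right (min κ (τ / 2) / r) (τ / 2)]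
  · have h1 := hB₁.add_le hB₂ (A := A) (by
      filter_upwards [hnhds x hxη] with y hy
      have h2 := isMaxOn_iff.mp hW y hy
      have h3 := hPT x y
      rw [hpp, inner_add_left, inner_sub_right q]
      linarith) w
    have e1 : A w w = B w w + 2 * k * ‖w‖ ^ 2 := by
      rw [← innerForm_apply_self]
      rfl
    have e2 : (B₁ + (2 * (τ / 4) - k) • innerForm (Euc n) +
        (B₂ + (2 * (τ / 4) - k) • innerForm (Euc n))) w w =
        B₁ w w + (2 * (τ / 4) - k) * ‖w‖ ^ 2 + (B₂ w w + (2 * (τ / 4) - k) * ‖w‖ ^ 2) := by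
      rw [← innerForm_apply_self]
      rfl
    rw [e2]
    rw [e1] at h1
    linarith
  · have h1 := hQη x (ball_subset_ball hηη₁ hxη)
    linarith [min_le_right κ (τ / 2)]

/-- The difference of a subsolution and a supersolution of equations governed by the same operator
is a subsolution of the extremal equation. -/
theorem IsViscositySubsolution.sub {p : ℕ} {lam Lam b c : ℝ} (hlam : 0 < lam) (hLam : lam ≤ Lam)
    (hb : 0 ≤ b) (hc : 0 ≤ c) {Ω : TopologicalSpace.Opens (Euc n)}
    {F : ℝ → Euc n → SymMat n → ℝ} (hF : StructureCondition lam Lam p b c F) {f g : Euc n → ℝ}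
    (hf : ContinuousOn f (Ω : Set (Euc n))) (hg : ContinuousOn g (Ω : Set (Euc n)))
    {u v : Euc n → EReal} (hu : IsViscositySubsolution Ω F f u)
    (hv : IsViscositySupersolution Ω F g v) :
    IsViscositySubsolution Ω (fun t ξ X => pucciMax lam Lam p X + b * ‖ξ‖ - c * t)
      (fun x => f x - g x) (fun x => u x - v x) := by
  have hv' := hv.neg
  refine ⟨?_, fun x hx => ?_, fun x₀ hx₀ hb₀ φ hφ hmax => ?_⟩
  · simp only [sub_eq_add_neg]
    exact hu.usc.add' hv'.usc fun x hx =>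
      EReal.continuousAt_add (Or.inl (hu.lt_top x hx).ne) (Or.inr (hv'.lt_top x hx).ne)
  · rw [sub_eq_add_neg]
    exact EReal.add_lt_top (hu.lt_top x hx).ne (hv'.lt_top x hx).ne
  have hu₀ : ⊥ < u x₀ := by
    rw [bot_lt_iff_ne_bot]
    intro h
    rw [h, sub_eq_add_neg, EReal.bot_add] at hb₀
    exact lt_irrefl _ hb₀
  have hv₀ : ⊥ < -v x₀ := by
    rw [bot_lt_iff_ne_bot]
    intro h
    rw [sub_eq_add_neg, h, EReal.add_bot] at hb₀
    exact lt_irrefl _ hb₀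
  have hφ₀ := contDiffAt_of_mem hφ hx₀
  set m := (u x₀).toReal + (-v x₀).toReal with hm
  have hm₀ : u x₀ - v x₀ = (m : EReal) := by
    rw [sub_eq_add_neg, hm, EReal.coe_add, EReal.coe_toReal (hu.lt_top x₀ hx₀).ne hu₀.ne',
      EReal.coe_toReal (hv'.lt_top x₀ hx₀).ne hv₀.ne']
  have hm₁ : (u x₀ - v x₀).toReal = m := by rw [hm₀, EReal.toReal_coe]
  set P₀ := gradient φ x₀ with hP₀
  set B₀ := fderiv ℝ (fderiv ℝ φ) x₀ with hB₀
  have key : ∀ τ > 0, f x₀ - g x₀ - 2 * τ ≤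
      pucciMax lam Lam p (hessian φ x₀ hφ₀) + n * (Lam * (5 * τ)) + b * (‖P₀‖ + τ)
        - c * (m - τ) := by
    intro τ hτ
    -- Half of 4τ is 2τ: one τ absorbs the Taylor error, the other makes the maximum strict. The 5τ
    -- in `key` is this 4τ plus the τ lost in the theorem on sums.
    have hloc : ∀ᶠ y in 𝓝 x₀, y ∈ Ω ∧ u y + -v y ≤
        ((m + quadPoly x₀ P₀ (B₀ + (4 * τ) • innerForm (Euc n)) y - τ * ‖y - x₀‖ ^ 2 : ℝ) :
          EReal) := by
      have hnΩ := Ω.isOpen.mem_nhds hx₀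
      have hmax' := hmax
      rw [IsLocalMaxOn, IsMaxFilter, Ω.isOpen.nhdsWithin_eq hx₀] at hmax'
      filter_upwards [hnΩ, hmax', hasSecondOrderExpansion_of_contDiffAt hφ₀ τ hτ] with y h1 h2 h3
      refine ⟨h1, ?_⟩
      have h4 : u y - v y ≤ ((m - φ x₀ + φ y : ℝ) : EReal) := by
        have h5 := (EReal.sub_le_iff_le_add (Or.inl (EReal.coe_ne_bot _))
          (Or.inl (EReal.coe_ne_top _))).mp h2
        rwa [hm₀, ← EReal.coe_sub, ← EReal.coe_add] at h5
      rw [← sub_eq_add_neg]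
      refine h4.trans (EReal.coe_le_coe_iff.mpr ?_)
      have h6 := (abs_le.mp h3).2
      have h7 : (B₀ + (4 * τ) • innerForm (Euc n)) (y - x₀) (y - x₀) =
          B₀ (y - x₀) (y - x₀) + 4 * τ * ‖y - x₀‖ ^ 2 := by
        rw [← innerForm_apply_self]
        rfl
      rw [quadPoly, h7]
      linarith
    obtain ⟨r, hr, hball⟩ := nhds_basis_closedBall.mem_iff.mp hloc
    have hfg : ∀ᶠ y in 𝓝 x₀, f x₀ - τ < f y ∧ g y < g x₀ + τ :=
      ((hf.continuousAt (Ω.isOpen.mem_nhds hx₀)).eventually (lt_mem_nhds (by linarith))).and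
        ((hg.continuousAt (Ω.isOpen.mem_nhds hx₀)).eventually (gt_mem_nhds (by linarith)))
    obtain ⟨s, hs, hsball⟩ := Metric.eventually_nhds_iff_ball.mp hfg
    obtain ⟨y, z, p₁, p₂, B₁, B₂, hyΩ, hzΩ, hy, hz, hfy, hgz, hpp, hBB, hval⟩ :=
      exists_superjets hu hv' hu₀ hv₀ hr (fun y hy => (hball hy).1) hτ
        (fun y hy => (hball hy).2) (lt_min hs hτ)
    have hσ : min s τ ≤ τ := min_le_right _ _
    have hfy' := (hsball y (ball_subset_ball (min_le_left _ _) hy)).1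
    have hgz' := (hsball z (ball_subset_ball (min_le_left _ _) hz)).2
    -- The dual operator's data enter with signs reversed, so the differences in (SC) become the
    -- sums `B₁ + B₂` and `p₁ + p₂`.
    have hSC := hF (-(-v z).toReal) (u y).toReal (-p₂) p₁ (-symPart B₂) (symPart B₁)
    rw [sub_neg_eq_add, sub_neg_eq_add, sub_neg_eq_add, ← symPart_add] at hSC
    have hpucci : pucciMax lam Lam p (symPart (B₁ + B₂)) ≤
        pucciMax lam Lam p (hessian φ x₀ hφ₀) + n * (Lam * (5 * τ)) := by
      refine pucciMax_le_add hlam hLam p (by positivity) fun w => ?_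
      rw [hessian_eq_symPart, quadForm_symPart, quadForm_symPart]
      have h1 := hBB w
      have h7 : (B₀ + (4 * τ) • innerForm (Euc n)) w w = B₀ w w + 4 * τ * ‖w‖ ^ 2 := by
        rw [← innerForm_apply_self]
        rfl
      rw [h7] at h1
      have h8 := mul_le_mul_of_nonneg_right hσ (sq_nonneg ‖w‖)
      linarith
    have hgrad : ‖p₁ + p₂‖ ≤ ‖P₀‖ + τ := by
      have := norm_sub_norm_le (p₁ + p₂) P₀
      linarith
    have h1 := mul_le_mul_of_nonneg_left hgrad hb
    have h2 := mul_le_mul_of_nonneg_left (hval.trans' (sub_le_sub_left hσ _)) hc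
    linarith
  have hlim : Tendsto (fun τ : ℝ => pucciMax lam Lam p (hessian φ x₀ hφ₀) +
      n * (Lam * (5 * τ)) + b * (‖P₀‖ + τ) - c * (m - τ) + 2 * τ) (𝓝[>] 0)
      (𝓝 (pucciMax lam Lam p (hessian φ x₀ hφ₀) + b * ‖P₀‖ - c * m)) := by
    have hcont : Continuous (fun τ : ℝ => pucciMax lam Lam p (hessian φ x₀ hφ₀) +
      n * (Lam * (5 * τ)) + b * (‖P₀‖ + τ) - c * (m - τ) + 2 * τ) := by fun_prop
    simpa using (hcont.tendsto 0).mono_left nhdsWithin_le_nhds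
  rw [hm₁]
  refine ge_of_tendsto hlim ?_
  filter_upwards [self_mem_nhdsWithin] with τ hτ
  linarith [key τ hτ]

end DegeneratePucci

end

theorem lemma3p1 {n p : ℕ} (hp : 1 ≤ p) (hpn : p ≤ n)
    {lam Lam b c : ℝ} (hlam : 0 < lam) (hLam : lam ≤ Lam) (hb : 0 ≤ b) (hc : 0 ≤ c)
    (Ω : TopologicalSpace.Opens (DegeneratePucci.Euc n))
    (F : ℝ → DegeneratePucci.Euc n → DegeneratePucci.SymMat n → ℝ)
    (hF : DegeneratePucci.StructureCondition lam Lam p b c F)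
    (f g : DegeneratePucci.Euc n → ℝ)
    (hf : ContinuousOn f (Ω : Set (DegeneratePucci.Euc n)))
    (hg : ContinuousOn g (Ω : Set (DegeneratePucci.Euc n)))
    (u v : DegeneratePucci.Euc n → EReal)
    (hu : DegeneratePucci.IsViscositySubsolution Ω F f u)
    (hv : DegeneratePucci.IsViscositySupersolution Ω F g v) :
    DegeneratePucci.IsViscositySubsolution Ω
      (fun t ξ X => DegeneratePucci.pucciMax lam Lam p X + b * ‖ξ‖ - c * t)
      (fun x => f x - g x) (fun x => u x - v x) := by
  exact hu.sub hlam hLam hb hc hF hf hg hv
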